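/- **Theorem (Quantitative Bounds).** Let $\mathcal{M}$ be a matroid on the ground set $[m]=\{1,\dots,m\}$ of rank $n$, let $\mathcal{B}\subseteq\binom{[m]}{n}$ be its family of bases, and let $\mathcal{B}^\star=\{[m]\setminus S: S\in\mathcal{B}\}$ be the family of bases of the dual matroid $\mathcal{M}^\star$. *Definitions.* A polynomial $g\in\mathbb{R}[z_1,\dots,z_m]$ is real stable if it has no zero $z\in\mathbb{C}^m$ with $\operatorname{Im} z_i>0$ for all $i$. For $g$ with nonnegative coefficients let $g_S$ be the coefficient of $z^S=\prod_{i\in S}z_i$, $g_{\mathcal{B}}=\sum_{S\in\mathcal{B}}g_S$, and $$\mathrm{Cap}_{\mathcal{B}}(g)=\sup_{\theta\in P(\mathcal{B})}\ \inf_{z\in\mathbb{R}_{>0}^m}\frac{g(z)}{\prod_{i=1}^m z_i^{\theta_i}},\qquad P(\mathcal{B})=\mathrm{conv}\{1_S:S\in\mathcal{B}\}.$$ Let $M(\mathcal{B})$ be the supremum of $\mathrm{Cap}_{\mathcal{B}}(g)/g_{\mathcal{B}}$ over all real stable, $n$-homogeneous polynomials $g$ in $m$ variables with nonnegative coefficients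 and $g_{\mathcal{B}}>0$, and let $M_{\mathrm{lin}}(\mathcal{B})$ be the same supremum over those $g$ that are in addition multiaffine (only square-free monomials occur). A real matrix $V$ with rows $v_1,\dots,v_m$ represents a matroid on $[m]$ if, for every $S\subseteq[m]$, $S$ is independent in the matroid if and only if the family $(v_i)_{i\in S}$ is linearly independent; a matroid is $\mathbb{R}$-linear if it has such a representation. For an $\mathbb{R}$-linear matroid $\mathcal{N}$ on $[m]$ of rank $r$, $\mathrm{un}(\mathcal{N})$ is the minimum, over all representations $V\in\mathbb{R}^{m\times r}$ of $\mathcal{N}$, of $\max\{\det(V_S^\top V_S)/\det(V_T^\top V_T): S,T \text{ bases of }\mathcal{N}\}$, where $V_S$ is the submatrix of the rows of $V$ with index in $S$. *Claim.* (With the convention $0^0=1$.) 1. **Strongly Rayleigh.** Let $(p_S)_{S\in\mathcal{B}^\star}$ be a probability distribution with $p_S>0$ for every $S\in\mathcal{B}^\star$ whose generating polynomial $\sum_{S\in\mathcal{B}^\star}p_S z^S$ is real stable, and let $P=\max_{S,T\in\mathcal{B}^\star}p_S/p_T$. Then $M(\mathcal{B})\le P\cdot\frac{m^m}{m!}$ and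 $M_{\mathrm{lin}}(\mathcal{B})\le P\cdot 2^m$. 2. **Linear matroids.** If $\mathcal{M}$ is $\mathbb{R}$-linear, then $M(\mathcal{B})\le \mathrm{un}(\mathcal{M}^\star)\cdot\frac{m^m}{m!}$ and $M_{\mathrm{lin}}(\mathcal{B})\le \mathrm{un}(\mathcal{M}^\star)\cdot 2^m$. 3. **Partition matroids.** Let $P_1,\dots,P_p$ be a partition of $[m]$ into non-empty sets and $b_1,\dots,b_p$ integers with $0\le b_j\le|P_j|$, and suppose that $\mathcal{B}=\{S\subseteq[m]:|S\cap P_j|=b_j\text{ for all }j\}$. Then $$M(\mathcal{B})\le\frac{m^m}{m!}\prod_{j=1}^p\frac{(|P_j|-b_j)!}{(|P_j|-b_j)^{|P_j|-b_j}}\le e^{n+p}\left(\frac{m}{p}\right)^{p/2},\qquad M_{\mathrm{lin}}(\mathcal{B})\le\frac{n^n}{n!}\prod_{j=1}^p\frac{b_j!}{b_j^{b_j}}$$ (for $m=p=0$ the factor $(m/p)^{p/2}$ is read as $1$). -/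

import Mathlib

noncomputable section

namespace BCapacity

open scoped BigOperators

/-- The exponent vector of the square-free monomial `z^S = ∏ i ∈ S, z i`. -/
def sqfreeExp {m : ℕ} (S : Finset (Fin m)) : Fin m →₀ ℕ :=
  ∑ i ∈ S, Finsupp.single i 1

/-- The characteristic vector `1_S` of `S`. -/
def charVec {m : ℕ} (S : Finset (Fin m)) : Fin m → ℝ :=
  fun i => if i ∈ S then 1 else 0

/-- The polytope `P(B) = conv {1_S : S ∈ B}`. -/
def basePolytope {m : ℕ} (B : Finset (Finset (Fin m))) : Set (Fin m → ℝ) :=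
  convexHull ℝ {x | ∃ S ∈ B, x = charVec S}

/-- The number `g_B = ∑ S ∈ B, g_S`, with `g_S` the coefficient of `z^S` in `g`. -/
def famCoeff {m : ℕ} (B : Finset (Finset (Fin m))) (g : MvPolynomial (Fin m) ℝ) : ℝ :=
  ∑ S ∈ B, MvPolynomial.coeff (sqfreeExp S) g

/-- The `B`-capacity `sup_{θ ∈ P(B)} inf_{z > 0} g(z) / ∏ i, z i ^ θ i`. If `g` has nonnegative
coefficients then the infimum is over a set of nonnegative numbers and is at most `g(1,…,1)`, so
all bounds exist in `ℝ` (as long as `B` is non-empty). -/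
def capacity {m : ℕ} (B : Finset (Finset (Fin m))) (g : MvPolynomial (Fin m) ℝ) : ℝ :=
  ⨆ θ : basePolytope B, ⨅ z : {z : Fin m → ℝ // ∀ i, 0 < z i},
    MvPolynomial.eval z.1 g / ∏ i, (z.1 i) ^ (θ.1 i)

/-- Real stability: no zero of `g` in `ℂ^m` has all its coordinates in the open upper
half-plane. -/
def RealStable {m : ℕ} (g : MvPolynomial (Fin m) ℝ) : Prop :=
  ∀ z : Fin m → ℂ, (∀ i, 0 < (z i).im) → MvPolynomial.aeval z g ≠ 0

/-- All coefficients are nonnegative. -/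
def NonnegCoeffs {m : ℕ} (g : MvPolynomial (Fin m) ℝ) : Prop :=
  ∀ α : Fin m →₀ ℕ, 0 ≤ MvPolynomial.coeff α g

/-- Only square-free monomials occur. -/
def Multiaffine {m : ℕ} (g : MvPolynomial (Fin m) ℝ) : Prop :=
  ∀ α ∈ g.support, ∀ i, α i ≤ 1

/-- The approximation ratio `M(B)` of a family `B` of `n`-element subsets of `[m]`: the supremum
of `Cap_B(g) / g_B`, taken in the extended reals. -/
def approxRatio {m : ℕ} (n : ℕ) (B : Finset (Finset (Fin m))) : EReal :=
  sSup {r : EReal | ∃ g : MvPolynomial (Fin m) ℝ, NonnegCoeffs g ∧ RealStable g ∧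
    g.IsHomogeneous n ∧ 0 < famCoeff B g ∧ r = ((capacity B g / famCoeff B g : ℝ) : EReal)}

/-- The approximation ratio `M_lin(B)`: as `M(B)`, but over multiaffine polynomials only. -/
def approxRatioLin {m : ℕ} (n : ℕ) (B : Finset (Finset (Fin m))) : EReal :=
  sSup {r : EReal | ∃ g : MvPolynomial (Fin m) ℝ, NonnegCoeffs g ∧ Multiaffine g ∧
    RealStable g ∧ g.IsHomogeneous n ∧ 0 < famCoeff B g ∧
    r = ((capacity B g / famCoeff B g : ℝ) : EReal)}

open Classical in
/-- The family of bases of a matroid, as a finset of finsets. -/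
def bases {m : ℕ} (M : Matroid (Fin m)) : Finset (Finset (Fin m)) :=
  Finset.univ.filter (fun S => M.IsBase (S : Set (Fin m)))

/-- The generating polynomial `∑ S, μ(S) z^S` of a function on subsets of `[m]`. -/
def genPoly {m : ℕ} (μ : Finset (Fin m) → ℝ) : MvPolynomial (Fin m) ℝ :=
  ∑ S : Finset (Fin m), MvPolynomial.monomial (sqfreeExp S) (μ S)

/-- `μ` is a strongly Rayleigh probability distribution on subsets of `[m]` whose support is
exactly `B`. -/
structure IsStronglyRayleighOn {m : ℕ} (B : Finset (Finset (Fin m)))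
    (μ : Finset (Fin m) → ℝ) : Prop where
  pos : ∀ S ∈ B, 0 < μ S
  zero : ∀ S, S ∉ B → μ S = 0
  sum_eq_one : ∑ S : Finset (Fin m), μ S = 1
  stable : RealStable (genPoly μ)

/-- The real matrix `V` (one row for each element of `[m]`) represents the matroid `M`. -/
def IsRepresentation {m d : ℕ} (M : Matroid (Fin m)) (V : Matrix (Fin m) (Fin d) ℝ) : Prop :=
  ∀ S : Finset (Fin m),
    M.Indep (S : Set (Fin m)) ↔ LinearIndependent ℝ (fun i : {i // i ∈ S} => V i.1)

/-- A matroid is `ℝ`-linear if some real matrix represents it. -/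
def IsRealLinear {m : ℕ} (M : Matroid (Fin m)) : Prop :=
  ∃ (d : ℕ) (V : Matrix (Fin m) (Fin d) ℝ), IsRepresentation M V

/-- The submatrix `V_S` formed by the rows with index in `S`. -/
def rowSubmatrix {m d : ℕ} (V : Matrix (Fin m) (Fin d) ℝ) (S : Finset (Fin m)) :
    Matrix {i // i ∈ S} (Fin d) ℝ :=
  V.submatrix (fun i => i.1) id

/-- The determinant `det (V_Sᵀ V_S)`. -/
def rowDet {m d : ℕ} (V : Matrix (Fin m) (Fin d) ℝ) (S : Finset (Fin m)) : ℝ :=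
  ((rowSubmatrix V S).transpose * rowSubmatrix V S).det

/-- The unbalance of a matrix with respect to a family `B`: the largest ratio
`det (V_Sᵀ V_S) / det (V_Tᵀ V_T)` over `S, T ∈ B` (a maximum over a finite set). -/
def matrixUnbalance {m d : ℕ} (B : Finset (Finset (Fin m))) (V : Matrix (Fin m) (Fin d) ℝ) : ℝ :=
  sSup {r : ℝ | ∃ S ∈ B, ∃ T ∈ B, r = rowDet V S / rowDet V T}

/-- The unbalance of an `ℝ`-linear matroid: the least unbalance of a representation. The
representations have as many columns as the rank of the matroid; this is what makes
`det (V_Sᵀ V_S)` nonzero for the bases `S`, and any representation can be brought to this form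
by taking orthonormal coordinates on its row space, which keeps all inner products of rows. -/
def unbalance {m : ℕ} (M : Matroid (Fin m)) : ℝ :=
  sInf {r : ℝ | ∃ (d : ℕ) (V : Matrix (Fin m) (Fin d) ℝ), M.eRank = (d : ℕ∞) ∧
    IsRepresentation M V ∧ r = matrixUnbalance (bases M) V}

/-- `M` is the partition matroid `{U(P_j, b_j)}_j`: the `P_j` are non-empty and partition `[m]`,
`b_j ≤ |P_j|`, and the bases are the sets which meet each `P_j` in exactly `b_j` elements. -/
structure IsPartitionMatroid {m p : ℕ} (M : Matroid (Fin m))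
    (P : Fin p → Finset (Fin m)) (b : Fin p → ℕ) : Prop where
  nonempty : ∀ j, (P j).Nonempty
  disjoint : ∀ i j, i ≠ j → Disjoint (P i) (P j)
  cover : ∀ x, ∃ j, x ∈ P j
  le_card : ∀ j, b j ≤ (P j).card
  isBase_iff : ∀ S : Finset (Fin m),
    M.IsBase (S : Set (Fin m)) ↔ ∀ j, (S ∩ P j).card = b j

end BCapacity

end

/-! All upper bounds come from one inequality of Gurvits, `HurwitzStable.gurvits`: if a homogeneous
stable `f` of degree `m` in `m` variables satisfies `f(x) ≥ c ∏ x_i` on the positive orthant, then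
the coefficient of `z_1 ⋯ z_m` in `f` is at least `c` times a product of factors `((k-1)/k)^(k-1)`,
where `k` bounds the degree in the variable being eliminated. Without a degree restriction the
product is `m!/m^m`; with degree at most 2 in each variable it is at least `2^(-m)`.

To bound `Cap_B(g)`, fix `θ ∈ P(B)` with `g ≥ c z^θ` and multiply `g` by a stable selector `h` of
degree `m - n`, whose square-free monomials are exactly the complements of bases, with coefficients
at most `a`, and which satisfies `h ≥ b z^(1-θ)`. Then `g h ≥ c b ∏ z_i`, while the coefficient of
`z_1 ⋯ z_m` in `g h` is at most `a g_B`; Gurvits's inequality gives `c ≤ (a/b) · m^m/m! · g_B`, or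
`2^m` in place of `m^m/m!` if both factors are multiaffine (`le_famCoeff_of_selector`).

The selectors are: the generating polynomial of a strongly Rayleigh distribution on the dual bases,
with `a/b = P`; for a linear matroid, `det(Vᵀ diag(z) V)` with `V` a representation of the dual,
which expands by Cauchy–Binet with weights `det(V_Sᵀ V_S)`; for a partition matroid, the product of
powers `(∑_{i ∈ P_j} z_i)^(|P_j| - b_j)`. The multiaffine bound for partition matroids uses no
selector: averages of new variables are substituted into `g`, block by block, giving a polynomial of
degree `n` in `n` variables.

Stability is used as Hurwitz stability (no zeros with all real parts positive), equivalent for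
homogeneous polynomials by rotating with `I`. The comparison `|f(Re z)| ≤ |f(z)|`
(`HurwitzStable.norm_eval_re_le`) holds up to the boundary, so lower bounds on the positive orthant
yield nonvanishing without a limit theorem for stable polynomials. -/

noncomputable section

namespace BCapacity

open scoped BigOperators

/-! ### Univariate polynomials with restricted roots. -/

open Polynomial in
lemma eval_eq_eval_zero_mul_prod {R : ℂ[X]} (h0 : R.eval 0 ≠ 0) (s : ℂ) :
    R.eval s = R.eval 0 * (R.roots.map (fun r => 1 - s / r)).prod := by
  have hs := IsAlgClosed.splits R
  rw [hs.eval_eq_prod_roots s, hs.eval_eq_prod_roots 0, mul_assoc, ← Multiset.prod_map_mul]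
  congr 2
  refine Multiset.map_congr rfl fun r hr => ?_
  have : r ≠ 0 := by
    rintro rfl
    exact h0 (isRoot_of_mem_roots hr)
  field_simp
  ring

-- After factoring out the value at 0, each root `r` contributes `1 - 1/r`, whose real part is 1
-- because `1/r` is purely imaginary.
open Polynomial in
lemma norm_eval_zero_le_norm_eval_one {R : ℂ[X]} (hR : ∀ r, R.eval r = 0 → r.re = 0) :
    ‖R.eval 0‖ ≤ ‖R.eval 1‖ := by
  by_cases h0 : R.eval 0 = 0
  · simp [h0]
  have key : ∀ A : Multiset ℂ, (∀ r ∈ A, r.re = 0) →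
      1 ≤ ‖(A.map (fun r => 1 - 1 / r)).prod‖ := by
    intro A
    induction A using Multiset.induction_on with
    | empty => simp
    | cons a A ih =>
      intro h
      rw [Multiset.map_cons, Multiset.prod_cons, norm_mul]
      refine one_le_mul_of_one_le_of_one_le ?_ (ih fun r hr => h r (Multiset.mem_cons_of_mem hr))
      refine le_trans ?_ (Complex.abs_re_le_norm _)
      have : (1 / a).re = 0 := by simp [Complex.inv_re, h a (Multiset.mem_cons_self a A)]
      simp only [Complex.sub_re, this]
      simp
  rw [eval_eq_eval_zero_mul_prod h0 1, norm_mul]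
  exact le_mul_of_one_le_right (norm_nonneg _)
    (key _ fun r hr => hR r (isRoot_of_mem_roots hr))

open Polynomial in
lemma exists_eq_C_mul_prod {R : ℝ[X]} (h0 : R.eval 0 ≠ 0)
    (hR : ∀ r : ℂ, aeval r R = 0 → r.im = 0 ∧ r.re ≤ 0) :
    ∃ A : Multiset ℝ, (∀ a ∈ A, 0 ≤ a) ∧ Multiset.card A ≤ R.natDegree ∧
      R = C (R.eval 0) * (A.map (fun a => 1 + C a * X)).prod := by
  set Q := R.map (algebraMap ℝ ℂ) with hQ
  have hev : ∀ t : ℝ, Q.eval (t : ℂ) = ((R.eval t : ℝ) : ℂ) := by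
    intro t
    rw [hQ, eval_map_algebraMap]
    exact aeval_algebraMap_apply_eq_algebraMap_eval t R
  have hQ0 : Q.eval 0 ≠ 0 := by
    have := hev 0
    rw [Complex.ofReal_zero] at this
    rw [this]
    exact_mod_cast h0
  have hroots : ∀ r ∈ Q.roots, r.im = 0 ∧ r.re ≤ 0 := fun r hr =>
    hR r (by rw [← eval_map_algebraMap]; exact isRoot_of_mem_roots hr)
  refine ⟨Q.roots.map (fun r => -(1 / r.re)), ?_, ?_, ?_⟩
  · intro a ha
    obtain ⟨r, hr, rfl⟩ := Multiset.mem_map.1 ha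
    have := (hroots r hr).2
    rw [← one_div_neg_eq_neg_one_div]
    exact one_div_nonneg.2 (by linarith)
  · rw [Multiset.card_map]
    exact (card_roots' Q).trans (natDegree_map_le)
  · refine Polynomial.funext fun t => ?_
    have h1 := eval_eq_eval_zero_mul_prod hQ0 (t : ℂ)
    have h2 := hev 0
    rw [Complex.ofReal_zero] at h2
    rw [hev, h2] at h1
    have h3 : (Q.roots.map (fun r => 1 - (t : ℂ) / r)) =
        (Q.roots.map (fun r => ((1 + -(1 / r.re) * t : ℝ) : ℂ))) := by
      refine Multiset.map_congr rfl fun r hr => ?_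
      have : r = (r.re : ℂ) := Complex.ext rfl (by simp [(hroots r hr).1])
      rw [this]
      push_cast
      simp
      ring
    have h4 : (Q.roots.map (fun r => ((1 + -(1 / r.re) * t : ℝ) : ℂ))).prod =
        (((Q.roots.map (fun r => (1 + -(1 / r.re) * t : ℝ))).prod : ℝ) : ℂ) := by
      have := Multiset.prod_hom (Q.roots.map (fun r => (1 + -(1 / r.re) * t : ℝ))) Complex.ofRealHom
      rw [Multiset.map_map] at this
      simpa using this
    rw [h3, h4] at h1
    rw [eval_mul, eval_C, eval_multiset_prod, Multiset.map_map, Multiset.map_map]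
    simp only [Function.comp_apply, eval_add, eval_one, eval_mul, eval_C, eval_X]
    exact_mod_cast h1

open Polynomial in
lemma coeff_one_prod (A : Multiset ℝ) :
    ((A.map (fun a => 1 + C a * X)).prod).coeff 0 = 1 ∧
    ((A.map (fun a => 1 + C a * X)).prod).coeff 1 = A.sum := by
  induction A using Multiset.induction_on with
  | empty => simp [coeff_one]
  | cons a A ih =>
    obtain ⟨h0, h1⟩ := ih
    rw [Multiset.map_cons, Multiset.prod_cons, add_mul, one_mul, mul_assoc]
    constructor
    · simp [h0]
    · rw [coeff_add, coeff_C_mul, coeff_X_mul, h0, h1, Multiset.sum_cons]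
      ring

/-- AM-GM for `k` factors with mean `1 + τ`, those missing from `A` being equal to 1. It is proved
by the tangent bound `1 + x ≤ (1 + τ) exp((x - τ)/(1 + τ))`, whose exponents cancel in total. -/
lemma prod_one_add_mul_le {A : Multiset ℝ} (hA : ∀ a ∈ A, 0 ≤ a) {k : ℕ}
    (hk : Multiset.card A ≤ k) {t τ : ℝ} (ht : 0 ≤ t) (hτ : 0 ≤ τ) (h : A.sum * t = k * τ) :
    (A.map (fun a => 1 + a * t)).prod ≤ (1 + τ) ^ k := by
  have hτ1 : 0 < 1 + τ := by linarith
  have key : (A.map (fun a => 1 + a * t)).prod ≤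
      (1 + τ) ^ (Multiset.card A) * Real.exp ((A.sum * t - Multiset.card A * τ) / (1 + τ)) := by
    clear h hk
    induction A using Multiset.induction_on with
    | empty => simp
    | cons a A ih =>
      have ih' := ih fun r hr => hA r (Multiset.mem_cons_of_mem hr)
      have ha := hA a (Multiset.mem_cons_self a A)
      rw [Multiset.map_cons, Multiset.prod_cons, Multiset.card_cons, Multiset.sum_cons]
      have h1 : 1 + a * t ≤ (1 + τ) * Real.exp ((a * t - τ) / (1 + τ)) := by
        have := Real.add_one_le_exp ((a * t - τ) / (1 + τ))
        calc 1 + a * t = (1 + τ) * ((a * t - τ) / (1 + τ) + 1) := by field_simp; ring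
          _ ≤ _ := by gcongr
      have h2 : Real.exp (((a + A.sum) * t - ((Multiset.card A + 1 : ℕ) : ℝ) * τ) / (1 + τ)) =
          Real.exp ((a * t - τ) / (1 + τ)) *
            Real.exp ((A.sum * t - Multiset.card A * τ) / (1 + τ)) := by
        rw [← Real.exp_add]
        congr 1
        push_cast
        ring
      rw [h2]
      calc (1 + a * t) * (A.map (fun a => 1 + a * t)).prod
          ≤ ((1 + τ) * Real.exp ((a * t - τ) / (1 + τ))) *
            ((1 + τ) ^ (Multiset.card A) *
              Real.exp ((A.sum * t - Multiset.card A * τ) / (1 + τ))) := by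
            apply mul_le_mul h1 ih' _ (by positivity)
            apply Multiset.prod_nonneg
            intro x hx
            obtain ⟨r, hr, rfl⟩ := Multiset.mem_map.1 hx
            have := hA r (Multiset.mem_cons_of_mem hr)
            positivity
        _ = _ := by ring
  -- This is the tangent bound at `x = 0`; it pays for each of the `k - card A` missing factors.
  have h3 : Real.exp (τ / (1 + τ)) ≤ 1 + τ := by
    have := Real.one_sub_le_exp_neg (τ / (1 + τ))
    have h4 : 1 - τ / (1 + τ) = (1 + τ)⁻¹ := by field_simp; ring
    rw [h4, Real.exp_neg] at this
    exact (inv_le_inv₀ hτ1 (Real.exp_pos _)).1 this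
  refine key.trans ?_
  obtain ⟨d, rfl⟩ := Nat.exists_eq_add_of_le hk
  rw [h, pow_add]
  gcongr
  calc Real.exp ((((Multiset.card A + d : ℕ) : ℝ) * τ - Multiset.card A * τ) / (1 + τ))
      = Real.exp (τ / (1 + τ)) ^ d := by
        rw [← Real.exp_nat_mul]
        congr 1
        push_cast
        ring
    _ ≤ _ := by gcongr

/-- Gurvits's factor `((k - 1) / k) ^ (k - 1)`. -/
def gurvitsFactor (k : ℕ) : ℝ := (((k - 1 : ℕ) : ℝ) / k) ^ (k - 1)

lemma gurvitsFactor_le_one (k : ℕ) : gurvitsFactor k ≤ 1 := by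
  unfold gurvitsFactor
  refine pow_le_one₀ (by positivity) (div_le_one_of_le₀ ?_ (by positivity))
  exact_mod_cast Nat.sub_le k 1

lemma gurvitsFactor_pos {k : ℕ} (hk : 1 ≤ k) : 0 < gurvitsFactor k := by
  unfold gurvitsFactor
  rcases hk.eq_or_lt with rfl | h
  · simp
  · have : 0 < k - 1 := by omega
    positivity

open Polynomial Filter Topology in
/-- Gurvits's inequality for univariate polynomials with real nonpositive roots. -/
lemma mul_gurvitsFactor_le_coeff_one {R : ℝ[X]} {c : ℝ} (hc : 0 < c)
    (hR : ∀ r : ℂ, aeval r R = 0 → r.im = 0 ∧ r.re ≤ 0)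
    (hge : ∀ t : ℝ, 0 < t → c * t ≤ R.eval t) {k : ℕ} (hk : 1 ≤ k) (hdeg : R.natDegree ≤ k) :
    c * gurvitsFactor k ≤ R.coeff 1 := by
  have hlim : Tendsto (fun t : ℝ => R.eval t) (𝓝[>] 0) (𝓝 (R.eval 0)) :=
    (R.continuous.tendsto 0).mono_left nhdsWithin_le_nhds
  have h0 : 0 ≤ R.eval 0 := by
    refine ge_of_tendsto hlim ?_
    filter_upwards [self_mem_nhdsWithin] with t ht
    have : (0 : ℝ) < t := ht
    exact le_trans (by positivity) (hge t ht)
  -- If `R(0) = 0`, the linear coefficient is the limit of `R(t)/t ≥ c`, and no loss occurs.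
  -- Otherwise AM-GM on the factors of `R` gives `c t ≤ R(0) (1 + s t/k)^k` with `s` the sum of the
  -- `a`'s, and `t` is optimized.
  rcases h0.eq_or_lt with h0 | h0
  · have hX : R = X * R.divX := by
      have := R.divX_mul_X_add
      rw [coeff_zero_eq_eval_zero, ← h0, C_0, add_zero] at this
      rw [mul_comm]; exact this.symm
    have h1 : R.coeff 1 = R.divX.eval 0 := by
      rw [← coeff_zero_eq_eval_zero, coeff_divX]
    have hlim' : Tendsto (fun t : ℝ => R.divX.eval t) (𝓝[>] 0) (𝓝 (R.divX.eval 0)) :=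
      (R.divX.continuous.tendsto 0).mono_left nhdsWithin_le_nhds
    have h2 : c ≤ R.divX.eval 0 := by
      refine ge_of_tendsto hlim' ?_
      filter_upwards [self_mem_nhdsWithin] with t ht
      have ht' : (0 : ℝ) < t := ht
      have := hge t ht
      rw [hX, eval_mul, eval_X, mul_comm] at this
      exact le_of_mul_le_mul_left this ht'
    rw [h1]
    exact (mul_le_of_le_one_right hc.le (gurvitsFactor_le_one k)).trans h2
  · obtain ⟨A, hA, hcard, hprod⟩ := exists_eq_C_mul_prod h0.ne' hR
    have hcoeff : R.coeff 1 = R.eval 0 * A.sum := by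
      conv_lhs => rw [hprod]
      rw [coeff_C_mul, (coeff_one_prod A).2]
    have heval : ∀ t, R.eval t = R.eval 0 * (A.map (fun a => 1 + a * t)).prod := by
      intro t
      conv_lhs => rw [hprod]
      rw [eval_mul, eval_C, eval_multiset_prod, Multiset.map_map]
      simp
    have hs : 0 ≤ A.sum := Multiset.sum_nonneg hA
    have hkA := hcard.trans hdeg
    have hk0 : (0 : ℝ) < k := by exact_mod_cast hk
    have hbound : ∀ t : ℝ, 0 < t → c * t ≤ R.eval 0 * (1 + A.sum * t / k) ^ k := by
      intro t ht
      refine (hge t ht).trans ?_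
      rw [heval t]
      gcongr
      exact prod_one_add_mul_le hA hkA ht.le (by positivity) (by field_simp)
    rcases hs.eq_or_lt with hs | hs
    · exfalso
      have := hbound ((R.eval 0 + 1) / c) (by positivity)
      rw [← hs] at this
      rw [mul_div_cancel₀ _ hc.ne'] at this
      simp at this
      linarith
    · rw [hcoeff]
      -- For `k = 1` the infimum of `R(0)(1 + s t)/t` is only approached as `t → ∞`, so a
      -- sufficiently large `t` gives a contradiction instead.
      rcases hk.eq_or_lt with rfl | hk1
      · have : gurvitsFactor 1 = 1 := by simp [gurvitsFactor]
        rw [this, mul_one]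
        by_contra! hlt
        set s := R.eval 0 * A.sum
        have := hbound ((R.eval 0 + 1) / (c - s)) (div_pos (by linarith) (by linarith))
        simp only [Nat.cast_one, div_one, pow_one] at this
        have h5 : (c - s) * ((R.eval 0 + 1) / (c - s)) = R.eval 0 + 1 :=
          mul_div_cancel₀ _ (by linarith)
        have h6 : R.eval 0 * (1 + A.sum * ((R.eval 0 + 1) / (c - s))) =
          R.eval 0 + s * ((R.eval 0 + 1) / (c - s)) := by ring
        linarith
      · obtain ⟨j, rfl⟩ : ∃ j, k = j + 1 := ⟨k - 1, by omega⟩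
        have hj : (0 : ℝ) < j := by exact_mod_cast (by omega : 0 < j)
        -- With `k = j + 1`, this `t` minimizes `(1 + s t/k)^k / t`.
        have h7 := hbound ((j + 1 : ℝ) / (A.sum * j)) (by positivity)
        have h8 : 1 + A.sum * ((j + 1 : ℝ) / (A.sum * j)) / ((j + 1 : ℕ) : ℝ) = (j + 1) / j := by
          push_cast
          field_simp
        rw [h8] at h7
        unfold gurvitsFactor
        simp only [Nat.add_sub_cancel]
        push_cast
        have h9 : ((j + 1 : ℝ) / j) ^ (j + 1) = ((j + 1 : ℝ) / j) * ((j + 1 : ℝ) / j) ^ j := by ring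
        rw [h9] at h7
        have h10 : ((j + 1 : ℝ) / j) ^ j * ((j : ℝ) / (j + 1)) ^ j = 1 := by
          rw [← mul_pow]
          have : ((j + 1 : ℝ) / j) * ((j : ℝ) / (j + 1)) = 1 := by field_simp
          rw [this, one_pow]
        have h11 := mul_le_mul_of_nonneg_right h7
          (by positivity : (0 : ℝ) ≤ ((j : ℝ) / (j + 1)) ^ j * (A.sum * j / (j + 1)))
        calc c * ((j : ℝ) / (j + 1)) ^ j
            = c * ((j + 1 : ℝ) / (A.sum * j)) *
              (((j : ℝ) / (j + 1)) ^ j * (A.sum * j / (j + 1))) := by field_simp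
          _ ≤ _ := h11
          _ = R.eval 0 * A.sum * (((j + 1 : ℝ) / j) ^ j * ((j : ℝ) / (j + 1)) ^ j) *
              (((j + 1 : ℝ) / j) * (j / (j + 1))) := by ring
          _ = _ := by rw [h10]; field_simp

/-! ### Hurwitz stability of homogeneous polynomials. -/

open MvPolynomial

/-- `f` has no zero all of whose coordinates have positive real part. -/
def HurwitzStable {σ : Type*} (f : MvPolynomial σ ℝ) : Prop :=
  ∀ z : σ → ℂ, (∀ i, 0 < (z i).re) → aeval z f ≠ 0

lemma aeval_const_mul {σ : Type*} [Fintype σ] {f : MvPolynomial σ ℝ} {d : ℕ}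
    (hf : f.IsHomogeneous d) (c : ℂ) (z : σ → ℂ) :
    aeval (fun i => c * z i) f = c ^ d * aeval z f := by
  rw [aeval_def, aeval_def, eval₂_eq', eval₂_eq', Finset.mul_sum]
  refine Finset.sum_congr rfl fun α hα => ?_
  have h := hf.degree_eq_sum_deg_support hα
  simp_rw [mul_pow, Finset.prod_mul_distrib, Finset.prod_pow_eq_pow_sum]
  have : ∑ i, α i = d := by
    rw [h]
    exact (Finset.sum_subset (Finset.subset_univ _) (by simp)).symm
  rw [this]
  ring

lemma aeval_ofReal {σ : Type*} (f : MvPolynomial σ ℝ) (x : σ → ℝ) :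
    aeval (fun i => (x i : ℂ)) f = ((eval x f : ℝ) : ℂ) := by
  have := aeval_algebraMap_apply ℂ x f
  simpa [Function.comp_def] using this

lemma continuous_aeval {σ : Type*} [Fintype σ] (f : MvPolynomial σ ℝ) :
    Continuous (fun z : σ → ℂ => aeval z f) := by
  simp only [aeval_def, eval₂_eq']
  fun_prop

lemma RealStable.hurwitzStable {m d : ℕ} {f : MvPolynomial (Fin m) ℝ} (hf : RealStable f)
    (hd : f.IsHomogeneous d) : HurwitzStable f := by
  intro z hz h0
  refine hf (fun i => Complex.I * z i) (fun i => by simpa using hz i) ?_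
  rw [aeval_const_mul hd, h0, mul_zero]

lemma HurwitzStable.mul {σ : Type*} {f g : MvPolynomial σ ℝ} (hf : HurwitzStable f)
    (hg : HurwitzStable g) : HurwitzStable (f * g) := by
  intro z hz
  rw [map_mul]
  exact mul_ne_zero (hf z hz) (hg z hz)

/-- Along the path `s ↦ Re z + i s Im z` the polynomial `f` has only purely imaginary roots in `s`,
so its value at `s = 1` dominates that at `s = 0`. -/
lemma HurwitzStable.norm_eval_re_le_of_pos {σ : Type*} [Fintype σ] {f : MvPolynomial σ ℝ} {d : ℕ}
    (hf : HurwitzStable f) (hd : f.IsHomogeneous d) (z : σ → ℂ) (hz : ∀ i, 0 < (z i).re) :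
    |eval (fun i => (z i).re) f| ≤ ‖aeval z f‖ := by
  set p : σ → Polynomial ℂ := fun i =>
    Polynomial.C ((z i).re : ℂ) + Polynomial.C (Complex.I * (z i).im) * Polynomial.X
  have hev : ∀ s : ℂ, (aeval p f).eval s =
      aeval (fun i => ((z i).re : ℂ) + Complex.I * (z i).im * s) f := by
    intro s
    have := comp_aeval_apply (R := ℝ) (f := p) ((Polynomial.aeval s).restrictScalars ℝ) f
    simp only [AlgHom.coe_restrictScalars', Polynomial.coe_aeval_eq_eval] at this
    rw [this]
    simp [p]
  have h := norm_eval_zero_le_norm_eval_one (R := aeval p f) (by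
    intro s hs
    by_contra hre
    have hs0 : s ≠ 0 := by rintro rfl; simp at hre
    rw [hev] at hs
    -- Scaling the point by `c = ±1/s`, with the sign that makes `Re c` positive, turns the
    -- imaginary term into `± i Im z` and leaves real parts `Re c · Re z_i > 0`; by homogeneity the
    -- scaled point is still a zero.
    have key : ∀ c : ℂ, 0 < c.re → (c * s = 1 ∨ c * s = -1) → False := by
      intro c hc hcs
      refine hf (fun i => c * (((z i).re : ℂ) + Complex.I * (z i).im * s)) (fun i => ?_) ?_
      · have : c * (((z i).re : ℂ) + Complex.I * (z i).im * s) =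
            c * ((z i).re : ℂ) + Complex.I * (z i).im * (c * s) := by ring
        rw [this]
        rcases hcs with h | h <;> rw [h] <;> simpa using mul_pos hc (hz i)
      · rw [aeval_const_mul hd, hs, mul_zero]
    have hre' : (s⁻¹).re = s.re / Complex.normSq s := Complex.inv_re s
    have hn : 0 < Complex.normSq s := Complex.normSq_pos.2 hs0
    rcases lt_or_gt_of_ne hre with h | h
    · refine key (-s⁻¹) ?_ (Or.inr (by field_simp))
      rw [Complex.neg_re, hre']
      have := div_neg_of_neg_of_pos h hn
      linarith
    · refine key s⁻¹ ?_ (Or.inl (by field_simp))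
      rw [hre']
      positivity)
  rw [hev, hev] at h
  simp only [mul_zero, add_zero, mul_one] at h
  rw [aeval_ofReal, Complex.norm_real, Real.norm_eq_abs] at h
  have hzz : (fun i => ((z i).re : ℂ) + Complex.I * (z i).im) = z := by
    funext i
    rw [mul_comm Complex.I]
    exact Complex.re_add_im _
  rwa [hzz] at h

/-- A homogeneous Hurwitz stable polynomial is at least as large at `z` as at `Re z`. -/
lemma HurwitzStable.norm_eval_re_le {σ : Type*} [Fintype σ] {f : MvPolynomial σ ℝ} {d : ℕ}
    (hf : HurwitzStable f) (hd : f.IsHomogeneous d) (z : σ → ℂ) (hz : ∀ i, 0 ≤ (z i).re) :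
    |eval (fun i => (z i).re) f| ≤ ‖aeval z f‖ := by
  have h1 : Continuous fun ε : ℝ => ‖aeval (fun i => z i + (ε : ℂ)) f‖ :=
    ((continuous_aeval f).comp (by fun_prop)).norm
  have h2 : Continuous fun ε : ℝ => |eval (fun i => (z i).re + ε) f| := by
    have := MvPolynomial.continuous_eval f
    exact (this.comp (by fun_prop)).abs
  have h3 := h1.tendsto 0
  have h4 := h2.tendsto 0
  simp only [Complex.ofReal_zero, add_zero] at h3 h4
  refine le_of_tendsto_of_tendsto
    (h4.mono_left (nhdsWithin_le_nhds : nhdsWithin (0 : ℝ) (Set.Ioi 0) ≤ _))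
    (h3.mono_left nhdsWithin_le_nhds) ?_
  filter_upwards [self_mem_nhdsWithin] with ε hε
  have hε' : (0 : ℝ) < ε := hε
  have := hf.norm_eval_re_le_of_pos hd (fun i => z i + (ε : ℂ))
    (fun i => by have := hz i; simp; linarith)
  simpa using this

/-! ### Elimination of one variable and Gurvits's inequality. -/

/-- The polynomial `f` as a univariate polynomial in its first variable, with the other variables
specialized to complex numbers. -/
def fiberPoly {n : ℕ} (f : MvPolynomial (Fin (n + 1)) ℝ) (z : Fin n → ℂ) : Polynomial ℂ :=
  (finSuccEquiv ℝ n f).map (aeval z : MvPolynomial (Fin n) ℝ →ₐ[ℝ] ℂ).toRingHom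

lemma eval_fiberPoly {n : ℕ} (f : MvPolynomial (Fin (n + 1)) ℝ) (z : Fin n → ℂ) (t : ℂ) :
    (fiberPoly f z).eval t = aeval (Fin.cons t z : Fin (n + 1) → ℂ) f := by
  unfold fiberPoly
  induction f using MvPolynomial.induction_on with
  | C a =>
    have : finSuccEquiv ℝ n (C a) = Polynomial.C (C a) := by
      simp [MvPolynomial.finSuccEquiv_apply]
    rw [this]
    simp
  | add p q hp hq => simp only [map_add, Polynomial.map_add, Polynomial.eval_add, hp, hq]
  | mul_X p i hp =>
    rw [map_mul, Polynomial.map_mul, Polynomial.eval_mul, hp, map_mul]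
    congr 1
    refine Fin.cases ?_ (fun j => ?_) i
    · simp [MvPolynomial.finSuccEquiv_X_zero]
    · simp [MvPolynomial.finSuccEquiv_X_succ]

lemma finSuccEquiv_pderiv_zero {n : ℕ} (f : MvPolynomial (Fin (n + 1)) ℝ) :
    finSuccEquiv ℝ n (pderiv 0 f) = Polynomial.derivative (finSuccEquiv ℝ n f) := by
  induction f using MvPolynomial.induction_on with
  | C a =>
    have : finSuccEquiv ℝ n (C a) = Polynomial.C (C a) := by
      simp [MvPolynomial.finSuccEquiv_apply]
    rw [this]
    simp
  | add p q hp hq => simp only [map_add, hp, hq]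
  | mul_X p i hp =>
    rw [Derivation.leibniz, map_add, smul_eq_mul, smul_eq_mul, map_mul, map_mul, map_mul, hp,
      Polynomial.derivative_mul]
    refine Fin.cases ?_ (fun j => ?_) i
    · simp [MvPolynomial.finSuccEquiv_X_zero]; ring
    · simp [MvPolynomial.finSuccEquiv_X_succ, pderiv_X, Fin.succ_ne_zero]; ring

lemma eval_derivative_fiberPoly {n : ℕ} (f : MvPolynomial (Fin (n + 1)) ℝ) (z : Fin n → ℂ)
    (t : ℂ) : (Polynomial.derivative (fiberPoly f z)).eval t =
      aeval (Fin.cons t z : Fin (n + 1) → ℂ) (pderiv 0 f) := by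
  rw [← eval_fiberPoly]
  unfold fiberPoly
  rw [finSuccEquiv_pderiv_zero, Polynomial.derivative_map]

lemma coeff_one_fiberPoly {n : ℕ} (f : MvPolynomial (Fin (n + 1)) ℝ) (z : Fin n → ℂ) :
    (fiberPoly f z).coeff 1 = aeval z ((finSuccEquiv ℝ n f).coeff 1) := by
  unfold fiberPoly
  rw [Polynomial.coeff_map]
  rfl

lemma aeval_cons_zero_pderiv {n : ℕ} (f : MvPolynomial (Fin (n + 1)) ℝ) (z : Fin n → ℂ) :
    aeval (Fin.cons 0 z : Fin (n + 1) → ℂ) (pderiv 0 f) =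
      aeval z ((finSuccEquiv ℝ n f).coeff 1) := by
  rw [← eval_derivative_fiberPoly, ← coeff_one_fiberPoly,
    ← Polynomial.coeff_zero_eq_eval_zero, Polynomial.coeff_derivative]
  simp

/-- Gauss–Lucas: with the other variables fixed in the right half-plane, all roots in the first
variable lie in the closed left half-plane, hence so do those of the derivative. The lower bound
`hge`, carried over to complex points by comparison with real parts, forces growth in the first
variable and so excludes a constant fiber. -/
lemma HurwitzStable.pderiv_zero {n d : ℕ} {f : MvPolynomial (Fin (n + 1)) ℝ} {c : ℝ}
    (hf : HurwitzStable f) (hd : f.IsHomogeneous d) (hc : 0 < c)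
    (hge : ∀ x : Fin (n + 1) → ℝ, (∀ i, 0 < x i) → c * ∏ i, x i ≤ eval x f) :
    HurwitzStable (pderiv 0 f) := by
  intro w hw
  obtain ⟨t, z, rfl⟩ : ∃ t z, w = (Fin.cons t z : Fin (n + 1) → ℂ) :=
    ⟨w 0, Fin.tail w, (Fin.cons_self_tail w).symm⟩
  have hz : ∀ i, 0 < (z i).re := fun i => by simpa using hw i.succ
  rw [← eval_derivative_fiberPoly]
  intro h0
  have hdeg : 0 < (fiberPoly f z).degree := by
    by_contra hdeg
    obtain ⟨a, ha⟩ : ∃ a, fiberPoly f z = Polynomial.C a :=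
      ⟨_, Polynomial.eq_C_of_degree_le_zero (not_lt.1 hdeg)⟩
    set Q := ∏ i, (z i).re with hQ
    have hQ0 : 0 < Q := Finset.prod_pos fun i _ => hz i
    have hle : ∀ s : ℝ, 0 < s → c * (s * Q) ≤ ‖a‖ := by
      intro s hs
      have h1 : aeval (Fin.cons (s : ℂ) z : Fin (n + 1) → ℂ) f = a := by
        rw [← eval_fiberPoly, ha, Polynomial.eval_C]
      have hpos : ∀ i, 0 < ((Fin.cons (s : ℂ) z : Fin (n + 1) → ℂ) i).re := by
        intro i
        refine Fin.cases ?_ (fun j => ?_) i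
        · simpa using hs
        · simpa using hz j
      have h2 := hf.norm_eval_re_le_of_pos hd _ hpos
      rw [h1] at h2
      have h3 := hge _ hpos
      rw [Fin.prod_univ_succ] at h3
      simp only [Fin.cons_zero, Fin.cons_succ, Complex.ofReal_re] at h3
      exact h3.trans ((le_abs_self _).trans h2)
    have := hle ((‖a‖ + 1) / (c * Q)) (by positivity)
    have h4 : c * ((‖a‖ + 1) / (c * Q) * Q) = ‖a‖ + 1 := by field_simp
    linarith
  have hmem : t ∈ (Polynomial.derivative (fiberPoly f z)).rootSet ℂ := by
    rw [Polynomial.mem_rootSet]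
    refine ⟨?_, by simpa using h0⟩
    intro h
    exact hdeg.not_ge (Polynomial.natDegree_eq_zero_iff_degree_le_zero.1
      (Polynomial.derivative_eq_zero.1 h))
  have := Polynomial.rootSet_derivative_subset_convexHull_rootSet hdeg hmem
  have hsub : convexHull ℝ ((fiberPoly f z).rootSet ℂ) ⊆ {u : ℂ | u.re ≤ 0} := by
    refine convexHull_min ?_ (convex_halfSpace_re_le 0)
    intro u hu
    have hu' : (fiberPoly f z).eval u = 0 := by
      simpa using (Polynomial.mem_rootSet.1 hu).2
    rw [eval_fiberPoly] at hu'
    by_contra hre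
    refine hf _ ?_ hu'
    intro i
    refine Fin.cases ?_ (fun j => ?_) i
    · simpa using hre
    · simpa using hz j
  have h5 := hsub this
  have h6 := hw 0
  simp only [Fin.cons_zero] at h6
  exact absurd h5 (not_le.2 h6)

/-- A root of the restriction of a homogeneous Hurwitz stable polynomial to a line through a
positive point in a coordinate direction is real and nonpositive. -/
lemma HurwitzStable.fiber_root {n d : ℕ} {f : MvPolynomial (Fin (n + 1)) ℝ}
    (hf : HurwitzStable f) (hd : f.IsHomogeneous d) {x : Fin n → ℝ} (hx : ∀ i, 0 < x i) {t : ℂ}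
    (ht : aeval (Fin.cons t (fun i => (x i : ℂ)) : Fin (n + 1) → ℂ) f = 0) :
    t.im = 0 ∧ t.re ≤ 0 := by
  by_contra hcon
  have hn : 0 < ‖t‖ + t.re := by
    by_contra hle
    have h1 : |t.re| ≤ ‖t‖ := Complex.abs_re_le_norm t
    have h2 : t.re ≤ -‖t‖ := by linarith
    have h3 : t.re = -‖t‖ := le_antisymm h2 (by have := abs_le.1 h1; linarith)
    apply hcon
    have h4 := Complex.sq_norm t
    rw [Complex.normSq_apply] at h4
    refine ⟨?_, by linarith [norm_nonneg t]⟩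
    have : ‖t‖ = -t.re := by linarith
    rw [this] at h4
    nlinarith
  -- The multiplier `|t| + conj t` has argument minus half that of `t`: it rotates both `t` and the
  -- positive axis into the open right half-plane unless `t` is real and nonpositive.
  have h1 : ∀ i, 0 < ((fun i => ((‖t‖ : ℂ) + (starRingEnd ℂ) t) *
      (Fin.cons t (fun i => (x i : ℂ)) : Fin (n + 1) → ℂ) i) i).re := by
    intro i
    refine Fin.cases ?_ (fun j => ?_) i
    · have ht0 : 0 < ‖t‖ := by
        rw [norm_pos_iff]; rintro rfl; simp at hn
      have : (((‖t‖ : ℂ) + (starRingEnd ℂ) t) * t) = ‖t‖ * (t + ‖t‖) := by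
        have h5 : (starRingEnd ℂ) t * t = (‖t‖ : ℂ) ^ 2 := by
          rw [mul_comm, Complex.mul_conj, Complex.normSq_eq_norm_sq]; push_cast; ring
        rw [add_mul, h5]; ring
      simp only [Fin.cons_zero]
      rw [this, Complex.re_ofReal_mul]
      have : 0 < t.re + ‖t‖ := by linarith
      simpa using mul_pos ht0 this
    · simp only [Fin.cons_succ]
      rw [mul_comm, Complex.re_ofReal_mul]
      simpa using mul_pos (hx j) hn
  refine hf _ h1 ?_
  rw [aeval_const_mul hd, ht, mul_zero]

/-- The lower bound of one elimination step in Gurvits's inequality. -/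
lemma HurwitzStable.le_eval_coeff_one {n d k : ℕ} {f : MvPolynomial (Fin (n + 1)) ℝ} {c : ℝ}
    (hf : HurwitzStable f) (hd : f.IsHomogeneous d) (hc : 0 < c)
    (hge : ∀ x : Fin (n + 1) → ℝ, (∀ i, 0 < x i) → c * ∏ i, x i ≤ eval x f)
    (hk : 1 ≤ k) (hdeg : degreeOf 0 f ≤ k) (x : Fin n → ℝ) (hx : ∀ i, 0 < x i) :
    c * gurvitsFactor k * ∏ i, x i ≤ eval x ((finSuccEquiv ℝ n f).coeff 1) := by
  set R : Polynomial ℝ := (finSuccEquiv ℝ n f).map (eval x) with hR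
  have hev : ∀ t : ℝ, R.eval t = eval (Fin.cons t x : Fin (n + 1) → ℝ) f := fun t =>
    (eval_eq_eval_mv_eval' x t f).symm
  have hRC : R.map (algebraMap ℝ ℂ) = fiberPoly f (fun i => (x i : ℂ)) := by
    rw [hR, Polynomial.map_map]
    unfold fiberPoly
    congr 1
    refine RingHom.ext fun p => ?_
    exact (aeval_ofReal p x).symm
  have hprod : 0 < ∏ i, x i := Finset.prod_pos fun i _ => hx i
  have h := mul_gurvitsFactor_le_coeff_one (R := R) (c := c * ∏ i, x i) (by positivity) (by
      intro r hr
      rw [← Polynomial.eval_map_algebraMap, hRC, eval_fiberPoly] at hr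
      exact hf.fiber_root hd hx hr) (by
      intro t ht
      rw [hev]
      have := hge (Fin.cons t x : Fin (n + 1) → ℝ) (fun i => by
        refine Fin.cases ?_ (fun j => ?_) i
        · simpa using ht
        · simpa using hx j)
      rw [Fin.prod_univ_succ] at this
      simp only [Fin.cons_zero, Fin.cons_succ] at this
      linarith) hk (by
      rw [← natDegree_finSuccEquiv] at hdeg
      exact Polynomial.natDegree_map_le.trans hdeg)
  rw [hR, Polynomial.coeff_map] at h
  calc c * gurvitsFactor k * ∏ i, x i = c * (∏ i, x i) * gurvitsFactor k := by ring
    _ ≤ _ := h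

/-- The coefficient is `∂_0 f` at the boundary value 0 of the first variable. Comparison with real
parts still applies there, and at the real point the univariate inequality gives a strictly positive
lower bound. -/
lemma HurwitzStable.coeff_one {n d : ℕ} {f : MvPolynomial (Fin (n + 1)) ℝ} {c : ℝ}
    (hf : HurwitzStable f) (hd : f.IsHomogeneous (d + 1)) (hc : 0 < c)
    (hge : ∀ x : Fin (n + 1) → ℝ, (∀ i, 0 < x i) → c * ∏ i, x i ≤ eval x f) :
    HurwitzStable ((finSuccEquiv ℝ n f).coeff 1) := by
  intro z hz
  have hD := hf.pderiv_zero hd hc hge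
  have hDd : (pderiv 0 f).IsHomogeneous d := by simpa using hd.pderiv (i := 0)
  have h1 := hD.norm_eval_re_le hDd (Fin.cons 0 z : Fin (n + 1) → ℂ) (fun i => by
    refine Fin.cases ?_ (fun j => ?_) i
    · simp
    · simpa using (hz j).le)
  rw [aeval_cons_zero_pderiv] at h1
  have h2 : (fun i => ((Fin.cons 0 z : Fin (n + 1) → ℂ) i).re) =
      (Fin.cons 0 (fun i => (z i).re) : Fin (n + 1) → ℝ) := by
    funext i
    refine Fin.cases ?_ (fun j => ?_) i <;> simp
  have h3 : eval (Fin.cons 0 (fun i => (z i).re) : Fin (n + 1) → ℝ) (pderiv 0 f) =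
      eval (fun i => (z i).re) ((finSuccEquiv ℝ n f).coeff 1) := by
    have h4 := aeval_cons_zero_pderiv f (fun i => ((z i).re : ℂ))
    rw [aeval_ofReal] at h4
    have h5 : (Fin.cons 0 (fun i => ((z i).re : ℂ)) : Fin (n + 1) → ℂ) =
        fun i => (((Fin.cons 0 (fun i => (z i).re) : Fin (n + 1) → ℝ) i : ℝ) : ℂ) := by
      funext i
      refine Fin.cases ?_ (fun j => ?_) i <;> simp
    rw [h5, aeval_ofReal] at h4
    exact_mod_cast h4
  rw [h2, h3] at h1
  have h6 := hf.le_eval_coeff_one hd hc hge (k := degreeOf 0 f + 1) (by omega) (by omega)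
    (fun i => (z i).re) hz
  have h7 : 0 < c * gurvitsFactor (degreeOf 0 f + 1) * ∏ i, (z i).re :=
    mul_pos (mul_pos hc (gurvitsFactor_pos (by omega))) (Finset.prod_pos fun i _ => hz i)
  intro h0
  rw [h0, norm_zero] at h1
  have := abs_nonpos_iff.1 h1
  linarith

lemma sqfreeExp_apply {m : ℕ} (S : Finset (Fin m)) (i : Fin m) :
    sqfreeExp S i = if i ∈ S then 1 else 0 := by
  classical
  simp [sqfreeExp, Finsupp.finsetSum_apply, Finsupp.single_apply]

/-- **Gurvits's inequality** for homogeneous Hurwitz stable polynomials with bounded degree in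
each variable. -/
theorem HurwitzStable.gurvits {m κ : ℕ} (hκ : 1 ≤ κ) {f : MvPolynomial (Fin m) ℝ} {c : ℝ}
    (hf : HurwitzStable f) (hd : f.IsHomogeneous m) (hc : 0 < c)
    (hge : ∀ x : Fin m → ℝ, (∀ i, 0 < x i) → c * ∏ i, x i ≤ eval x f)
    (hdeg : ∀ i, degreeOf i f ≤ κ) :
    c * ∏ i ∈ Finset.range m, gurvitsFactor (min (i + 1) κ) ≤
      coeff (sqfreeExp Finset.univ) f := by
  induction m generalizing c with
  | zero =>
    have h := hge (fun i => i.elim0) (fun i => i.elim0)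
    have h1 : f = C (coeff 0 f) := (totalDegree_eq_zero_iff_eq_C).1
      ((totalDegree_zero_iff_isHomogeneous _).2 hd)
    rw [h1] at h
    simpa [sqfreeExp] using h
  | succ n ih =>
    -- The degree in the eliminated variable is bounded both by `κ` and by the total degree, which
    -- equals the number `n + 1` of remaining variables.
    set k := min (n + 1) κ with hk
    have hk1 : 1 ≤ k := le_min (by omega) hκ
    have hk2 : degreeOf 0 f ≤ k :=
      le_min ((degreeOf_le_totalDegree f 0).trans hd.totalDegree_le) (hdeg 0)
    have h := ih (f := (finSuccEquiv ℝ n f).coeff 1) (c := c * gurvitsFactor k)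
      (hf.coeff_one hd hc hge)
      (hd.finSuccEquiv_coeff_isHomogeneous 1 n (by omega)) (mul_pos hc (gurvitsFactor_pos hk1))
      (fun x hx => hf.le_eval_coeff_one hd hc hge hk1 hk2 x hx)
      (fun i => (degreeOf_coeff_finSuccEquiv f i 1).trans (hdeg _))
    rw [finSuccEquiv_coeff_coeff] at h
    have hcons : (sqfreeExp (Finset.univ : Finset (Fin n))).cons 1 =
        sqfreeExp (Finset.univ : Finset (Fin (n + 1))) := by
      ext i
      refine Fin.cases ?_ (fun j => ?_) i <;> simp [sqfreeExp_apply]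
    rw [hcons] at h
    rw [Finset.prod_range_succ]
    calc _ = c * gurvitsFactor k * ∏ i ∈ Finset.range n, gurvitsFactor (min (i + 1) κ) := by ring
      _ ≤ _ := h

lemma prod_gurvitsFactor (m : ℕ) :
    ∏ i ∈ Finset.range m, gurvitsFactor (i + 1) = (m.factorial : ℝ) / (m : ℝ) ^ m := by
  induction m with
  | zero => simp
  | succ n ih =>
    rw [Finset.prod_range_succ, ih]
    unfold gurvitsFactor
    rcases Nat.eq_zero_or_pos n with rfl | hn
    · simp
    · have : (0 : ℝ) < n := by exact_mod_cast hn
      rw [Nat.factorial_succ]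
      simp only [Nat.add_sub_cancel]
      push_cast
      rw [div_pow]
      field_simp
      ring

theorem HurwitzStable.factorial_le_coeff {m : ℕ} {f : MvPolynomial (Fin m) ℝ} {c : ℝ}
    (hf : HurwitzStable f) (hd : f.IsHomogeneous m) (hc : 0 < c)
    (hge : ∀ x : Fin m → ℝ, (∀ i, 0 < x i) → c * ∏ i, x i ≤ eval x f) :
    c ≤ (m : ℝ) ^ m / m.factorial * coeff (sqfreeExp Finset.univ) f := by
  have h := hf.gurvits (κ := m + 1) (by omega) hd hc hge
    (fun i => ((degreeOf_le_totalDegree f i).trans hd.totalDegree_le).trans (Nat.le_succ m))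
  have h1 : ∏ i ∈ Finset.range m, gurvitsFactor (min (i + 1) (m + 1)) =
      (m.factorial : ℝ) / (m : ℝ) ^ m := by
    rw [← prod_gurvitsFactor]
    refine Finset.prod_congr rfl fun i hi => ?_
    rw [min_eq_left (by have := Finset.mem_range.1 hi; omega)]
  rw [h1] at h
  have h2 : (0 : ℝ) < (m : ℝ) ^ m := by
    rcases Nat.eq_zero_or_pos m with rfl | hm
    · simp
    · positivity
  have h3 : (0 : ℝ) < m.factorial := by positivity
  calc c = (m : ℝ) ^ m / m.factorial * (c * (m.factorial / (m : ℝ) ^ m)) := by field_simp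
    _ ≤ _ := by gcongr

theorem HurwitzStable.two_pow_le_coeff {m : ℕ} {f : MvPolynomial (Fin m) ℝ} {c : ℝ}
    (hf : HurwitzStable f) (hd : f.IsHomogeneous m) (hc : 0 < c)
    (hge : ∀ x : Fin m → ℝ, (∀ i, 0 < x i) → c * ∏ i, x i ≤ eval x f)
    (hdeg : ∀ i, degreeOf i f ≤ 2) :
    c ≤ 2 ^ m * coeff (sqfreeExp Finset.univ) f := by
  have h := hf.gurvits (κ := 2) (by omega) hd hc hge hdeg
  have h1 : (1 / 2 : ℝ) ^ m ≤ ∏ i ∈ Finset.range m, gurvitsFactor (min (i + 1) 2) := by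
    calc (1 / 2 : ℝ) ^ m = ∏ i ∈ Finset.range m, (1 / 2 : ℝ) := by simp
      _ ≤ _ := by
        refine Finset.prod_le_prod (fun i _ => by norm_num) fun i _ => ?_
        rcases Nat.eq_zero_or_pos i with rfl | hi
        · norm_num [gurvitsFactor]
        · rw [min_eq_right (by omega)]
          norm_num [gurvitsFactor]
  calc c = 2 ^ m * (c * (1 / 2) ^ m) := by
        have : (2 : ℝ) ^ m * (1 / 2) ^ m = 1 := by rw [← mul_pow]; norm_num
        linear_combination (-c) * this
    _ ≤ 2 ^ m * (c * ∏ i ∈ Finset.range m, gurvitsFactor (min (i + 1) 2)) := by gcongr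
    _ ≤ _ := by gcongr

/-! ### Square-free coefficients of products and the selector argument. -/

lemma sqfreeExp_injective {m : ℕ} :
    Function.Injective (sqfreeExp : Finset (Fin m) → Fin m →₀ ℕ) := by
  intro S T h
  ext i
  have := DFunLike.congr_fun h i
  rw [sqfreeExp_apply, sqfreeExp_apply] at this
  by_cases h1 : i ∈ S <;> by_cases h2 : i ∈ T <;> simp_all

lemma eq_sqfreeExp {m : ℕ} {α : Fin m →₀ ℕ} (h : ∀ i, α i ≤ 1) :
    α = sqfreeExp (Finset.univ.filter fun i => α i = 1) := by
  ext i
  rw [sqfreeExp_apply]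
  have := h i
  by_cases h1 : α i = 1
  · simp [h1]
  · simp [h1]; omega

lemma degree_sqfreeExp {m : ℕ} (S : Finset (Fin m)) : (sqfreeExp S).degree = S.card := by
  simp [sqfreeExp]

/-- The coefficient of `∏ i, z i` in a product. -/
lemma coeff_univ_mul {m : ℕ} (g h : MvPolynomial (Fin m) ℝ) :
    coeff (sqfreeExp Finset.univ) (g * h) =
      ∑ S : Finset (Fin m), coeff (sqfreeExp S) g * coeff (sqfreeExp Sᶜ) h := by
  classical
  rw [coeff_mul]
  symm
  refine Finset.sum_bij (fun S _ => (sqfreeExp S, sqfreeExp Sᶜ)) ?_ ?_ ?_ ?_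
  · intro S _
    rw [Finset.HasAntidiagonal.mem_antidiagonal]
    ext i
    by_cases h1 : i ∈ S <;> simp [sqfreeExp_apply, h1]
  · intro S _ T _ h
    exact sqfreeExp_injective (Prod.mk.inj h).1
  · rintro ⟨α, β⟩ hαβ
    rw [Finset.HasAntidiagonal.mem_antidiagonal] at hαβ
    have h1 : ∀ i, α i + β i = 1 := fun i => by
      have := DFunLike.congr_fun hαβ i
      simpa [sqfreeExp_apply] using this
    refine ⟨Finset.univ.filter fun i => α i = 1, Finset.mem_univ _, ?_⟩
    have h2 := eq_sqfreeExp (α := α) (fun i => by have := h1 i; omega)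
    have h3 : β = sqfreeExp (Finset.univ.filter fun i => α i = 1)ᶜ := by
      ext i
      rw [sqfreeExp_apply]
      have := h1 i
      by_cases h4 : α i = 1
      · simp [h4]; omega
      · simp [h4]; omega
    rw [← h3, ← h2]
  · intro S _
    rfl

lemma NonnegCoeffs.eval_nonneg {m : ℕ} {g : MvPolynomial (Fin m) ℝ} (hg : NonnegCoeffs g)
    {z : Fin m → ℝ} (hz : ∀ i, 0 ≤ z i) : 0 ≤ eval z g := by
  rw [eval_eq']
  exact Finset.sum_nonneg fun α _ =>
    mul_nonneg (hg α) (Finset.prod_nonneg fun i _ => pow_nonneg (hz i) _)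

/-- This removes the supremum and infimum: it suffices to bound each `c > 0` with `g ≥ c z^θ`, since
a nonpositive infimum satisfies the bound trivially. -/
lemma capacity_div_le {m : ℕ} {B : Finset (Finset (Fin m))} {g : MvPolynomial (Fin m) ℝ}
    (hB : B.Nonempty) (hg : NonnegCoeffs g) (hgB : 0 < famCoeff B g) {K : ℝ} (hK : 0 ≤ K)
    (h : ∀ θ ∈ basePolytope B, ∀ c : ℝ, 0 < c →
      (∀ z : Fin m → ℝ, (∀ i, 0 < z i) → c * ∏ i, z i ^ θ i ≤ eval z g) →
        c ≤ K * famCoeff B g) :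
    capacity B g / famCoeff B g ≤ K := by
  rw [div_le_iff₀ hgB]
  unfold capacity
  obtain ⟨S, hS⟩ := hB
  have hne : Nonempty (basePolytope B) := ⟨⟨charVec S, subset_convexHull ℝ _ ⟨S, hS, rfl⟩⟩⟩
  refine ciSup_le fun θ => ?_
  set c := ⨅ z : {z : Fin m → ℝ // ∀ i, 0 < z i}, eval z.1 g / ∏ i, (z.1 i) ^ (θ.1 i) with hc
  rcases le_or_gt c 0 with h0 | h0
  · exact h0.trans (mul_nonneg hK hgB.le)
  · refine h θ.1 θ.2 c h0 fun z hz => ?_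
    have hpos : 0 < ∏ i, z i ^ θ.1 i := Finset.prod_pos fun i _ => Real.rpow_pos_of_pos (hz i) _
    rw [← le_div_iff₀ hpos]
    refine ciInf_le (f := fun z : {z : Fin m → ℝ // ∀ i, 0 < z i} =>
      eval z.1 g / ∏ i, (z.1 i) ^ (θ.1 i)) ⟨0, ?_⟩ ⟨z, hz⟩
    rintro _ ⟨w, rfl⟩
    exact div_nonneg (hg.eval_nonneg fun i => (w.2 i).le)
      (Finset.prod_nonneg fun i _ => Real.rpow_nonneg (w.2 i).le _)

/-- The two bounds obtained by applying Gurvits's inequality to the product of `g` with a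
polynomial `h` that selects the complements of the members of `B`. -/
theorem le_famCoeff_of_selector {m n : ℕ} (hnm : n ≤ m) {B : Finset (Finset (Fin m))}
    {g h : MvPolynomial (Fin m) ℝ} (hg : NonnegCoeffs g) (hgs : HurwitzStable g)
    (hgd : g.IsHomogeneous n) (hhs : HurwitzStable h) (hhd : h.IsHomogeneous (m - n)) {a b : ℝ}
    (hb : 0 < b) (hcoeff : ∀ S ∈ B, coeff (sqfreeExp Sᶜ) h ≤ a)
    (hzero : ∀ S ∉ B, coeff (sqfreeExp Sᶜ) h = 0)
    {θ : Fin m → ℝ} (hlow : ∀ z : Fin m → ℝ, (∀ i, 0 < z i) → b * ∏ i, z i ^ (1 - θ i) ≤ eval z h)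
    {c : ℝ} (hc : 0 < c)
    (hge : ∀ z : Fin m → ℝ, (∀ i, 0 < z i) → c * ∏ i, z i ^ θ i ≤ eval z g) :
    c ≤ a / b * ((m : ℝ) ^ m / m.factorial) * famCoeff B g ∧
      ((∀ i, degreeOf i g ≤ 1) → (∀ i, degreeOf i h ≤ 1) →
        c ≤ a / b * 2 ^ m * famCoeff B g) := by
  have hs := hgs.mul hhs
  have hd := hgd.mul hhd
  rw [Nat.add_sub_of_le hnm] at hd
  have hge' : ∀ z : Fin m → ℝ, (∀ i, 0 < z i) → c * b * ∏ i, z i ≤ eval z (g * h) := by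
    intro z hz
    have h1 : ∏ i, z i = (∏ i, z i ^ θ i) * ∏ i, z i ^ (1 - θ i) := by
      rw [← Finset.prod_mul_distrib]
      refine Finset.prod_congr rfl fun i _ => ?_
      rw [← Real.rpow_add (hz i)]
      simp
    rw [h1, map_mul]
    calc c * b * ((∏ i, z i ^ θ i) * ∏ i, z i ^ (1 - θ i))
        = (c * ∏ i, z i ^ θ i) * (b * ∏ i, z i ^ (1 - θ i)) := by ring
      _ ≤ _ := mul_le_mul (hge z hz) (hlow z hz)
          (mul_nonneg hb.le (Finset.prod_nonneg fun i _ => Real.rpow_nonneg (hz i).le _))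
          (hg.eval_nonneg fun i => (hz i).le)
  have hco : coeff (sqfreeExp Finset.univ) (g * h) ≤ a * famCoeff B g := by
    rw [coeff_univ_mul, famCoeff, Finset.mul_sum,
      ← Finset.sum_subset (Finset.subset_univ B) (fun S _ hS => by rw [hzero S hS, mul_zero])]
    refine Finset.sum_le_sum fun S hS => ?_
    rw [mul_comm a]
    exact mul_le_mul_of_nonneg_left (hcoeff S hS) (hg _)
  have fin : ∀ K : ℝ, 0 ≤ K → c * b ≤ K * coeff (sqfreeExp Finset.univ) (g * h) →
      c ≤ a / b * K * famCoeff B g := by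
    intro K hK hle
    have := hle.trans (mul_le_mul_of_nonneg_left hco hK)
    rw [← le_div_iff₀ hb] at this
    calc c ≤ _ := this
      _ = _ := by ring
  refine ⟨fin _ (by positivity) (hs.factorial_le_coeff hd (by positivity) hge'),
    fun h1 h2 => fin _ (by positivity) (hs.two_pow_le_coeff hd (by positivity) hge' fun i => ?_)⟩
  exact (degreeOf_mul_le i g h).trans (add_le_add (h1 i) (h2 i))

/-! ### Generating polynomials of weights on dual bases. -/

lemma prod_pow_sqfreeExp {m : ℕ} {R : Type*} [CommSemiring R] (S : Finset (Fin m))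
    (z : Fin m → R) : ∏ i, z i ^ sqfreeExp S i = ∏ i ∈ S, z i := by
  simp_rw [sqfreeExp_apply, pow_ite, pow_one, pow_zero]
  rw [Finset.prod_ite_mem, Finset.univ_inter]

lemma coeff_sqfreeExp_genPoly {m : ℕ} (μ : Finset (Fin m) → ℝ) (S : Finset (Fin m)) :
    coeff (sqfreeExp S) (genPoly μ) = μ S := by
  classical
  unfold genPoly
  simp [coeff_sum, coeff_monomial, sqfreeExp_injective.eq_iff]

lemma eval_genPoly {m : ℕ} (μ : Finset (Fin m) → ℝ) (z : Fin m → ℝ) :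
    eval z (genPoly μ) = ∑ S, μ S * ∏ i ∈ S, z i := by
  unfold genPoly
  rw [map_sum]
  refine Finset.sum_congr rfl fun S _ => ?_
  rw [eval_monomial, Finsupp.prod_fintype _ _ (by simp), prod_pow_sqfreeExp]

lemma aeval_genPoly {m : ℕ} (μ : Finset (Fin m) → ℝ) (z : Fin m → ℂ) :
    aeval z (genPoly μ) = ∑ S, (μ S : ℂ) * ∏ i ∈ S, z i := by
  unfold genPoly
  rw [map_sum]
  refine Finset.sum_congr rfl fun S _ => ?_
  rw [aeval_monomial, Finsupp.prod_fintype _ _ (by simp), prod_pow_sqfreeExp]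
  rfl

lemma isHomogeneous_genPoly {m d : ℕ} {μ : Finset (Fin m) → ℝ}
    (hμ : ∀ S, μ S ≠ 0 → S.card = d) : (genPoly μ).IsHomogeneous d := by
  refine IsHomogeneous.sum _ _ _ fun S _ => ?_
  by_cases h : μ S = 0
  · rw [h, monomial_zero]
    exact isHomogeneous_zero _ _ _
  · exact isHomogeneous_monomial _ (by rw [degree_sqfreeExp, hμ S h])

lemma Multiaffine.degreeOf_le {m : ℕ} {g : MvPolynomial (Fin m) ℝ} (hg : Multiaffine g)
    (i : Fin m) : degreeOf i g ≤ 1 :=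
  degreeOf_le_iff.2 fun α hα => hg α hα i

lemma multiaffine_genPoly {m : ℕ} (μ : Finset (Fin m) → ℝ) : Multiaffine (genPoly μ) := by
  classical
  intro α hα i
  obtain ⟨S, -, hS⟩ := Finset.mem_biUnion.1 (support_sum hα)
  have : α = sqfreeExp S := by
    simpa using support_monomial_subset hS
  rw [this, sqfreeExp_apply]
  split_ifs <;> simp

lemma mem_bases {m : ℕ} {M : Matroid (Fin m)} {S : Finset (Fin m)} :
    S ∈ bases M ↔ M.IsBase (S : Set (Fin m)) := by
  simp [bases]

lemma bases_nonempty {m : ℕ} (M : Matroid (Fin m)) : (bases M).Nonempty := by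
  obtain ⟨B, hB⟩ := M.exists_isBase
  exact ⟨(Set.toFinite B).toFinset, mem_bases.2 (by simpa using hB)⟩

lemma mem_bases_dual {m : ℕ} {M : Matroid (Fin m)} (hE : M.E = Set.univ) {S : Finset (Fin m)} :
    S ∈ bases M.dual ↔ Sᶜ ∈ bases M := by
  rw [mem_bases, mem_bases, M.dual_isBase_iff (by rw [hE]; exact Set.subset_univ _), hE,
    Finset.coe_compl, Set.compl_eq_univ_sdiff]

/-- Weighted AM-GM: the monomial with exponent `1 - θ` is bounded by the sum of the monomials of
the complements of the members of `B`, for `θ` in the base polytope. -/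
lemma prod_rpow_one_sub_le {m : ℕ} {B : Finset (Finset (Fin m))} {θ : Fin m → ℝ}
    (hθ : θ ∈ basePolytope B) {z : Fin m → ℝ} (hz : ∀ i, 0 < z i) :
    ∏ i, z i ^ (1 - θ i) ≤ ∑ S ∈ B, ∏ i ∈ Sᶜ, z i := by
  classical
  have hexp : ∀ η : Fin m → ℝ, ∏ i, z i ^ (1 - η i) =
      Real.exp (∑ i, Real.log (z i) - ∑ i, Real.log (z i) * η i) := by
    intro η
    rw [← Finset.sum_sub_distrib, Real.exp_sum]
    refine Finset.prod_congr rfl fun i _ => ?_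
    rw [Real.rpow_def_of_pos (hz i)]
    congr 1
    ring
  have hchar : ∀ S, ∏ i, z i ^ (1 - charVec S i) = ∏ i ∈ Sᶜ, z i := by
    intro S
    rw [← Finset.prod_subset (Finset.subset_univ Sᶜ)]
    · refine Finset.prod_congr rfl fun i hi => ?_
      simp [charVec, Finset.mem_compl.1 hi]
    · intro i _ hi
      have : i ∈ S := by simpa using hi
      simp [charVec, this]
  have hpos : ∀ S : Finset (Fin m), 0 < ∏ i ∈ S, z i := fun S => Finset.prod_pos fun i _ => hz i
  have hne : B.Nonempty := by
    by_contra hB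
    rw [Finset.not_nonempty_iff_eq_empty] at hB
    subst hB
    simp [basePolytope] at hθ
  have hsum : 0 < ∑ S ∈ B, ∏ i ∈ Sᶜ, z i := Finset.sum_pos (fun S _ => hpos _) hne
  -- In logarithmic form the claim is a linear inequality in the exponent, so it passes from the
  -- vertices, where one summand is bounded by the sum, to their convex hull.
  have hsub : basePolytope B ⊆ {η | ∑ i, Real.log (z i) - Real.log (∑ S ∈ B, ∏ i ∈ Sᶜ, z i) ≤
      ∑ i, Real.log (z i) * η i} := by
    refine convexHull_min ?_ (convex_halfSpace_ge ⟨?_, ?_⟩ _)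
    · rintro _ ⟨S, hS, rfl⟩
      have h1 := Finset.single_le_sum (f := fun S => ∏ i ∈ Sᶜ, z i) (fun S _ => (hpos Sᶜ).le) hS
      rw [← hchar, hexp, ← Real.le_log_iff_exp_le hsum] at h1
      simp only [Set.mem_ofPred_eq]
      linarith
    · intro x y
      simp [mul_add, Finset.sum_add_distrib]
    · intro r x
      simp only [Pi.smul_apply, smul_eq_mul, Finset.mul_sum]
      exact Finset.sum_congr rfl fun i _ => by ring
  have h2 := hsub hθ
  simp only [Set.mem_ofPred_eq] at h2
  rw [hexp, ← Real.le_log_iff_exp_le hsum]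
  linarith

/-- Both approximation bounds, for a positive weight on the bases of the dual matroid with Hurwitz
stable generating polynomial and ratios at most `P`. -/
theorem capacity_div_le_of_weight {m n : ℕ} {M : Matroid (Fin m)} (hE : M.E = Set.univ)
    (hn : ∀ S ∈ bases M, S.card = n) {μ : Finset (Fin m) → ℝ} {P : ℝ}
    (hpos : ∀ S ∈ bases M.dual, 0 < μ S) (hzero : ∀ S, S ∉ bases M.dual → μ S = 0)
    (hμ : HurwitzStable (genPoly μ))
    (hP : ∀ S ∈ bases M.dual, ∀ T ∈ bases M.dual, μ S / μ T ≤ P)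
    {g : MvPolynomial (Fin m) ℝ} (hg : NonnegCoeffs g) (hgs : RealStable g)
    (hgd : g.IsHomogeneous n) (hgB : 0 < famCoeff (bases M) g) :
    capacity (bases M) g / famCoeff (bases M) g ≤ P * ((m : ℝ) ^ m / (m.factorial : ℝ)) ∧
      (Multiaffine g → capacity (bases M) g / famCoeff (bases M) g ≤ P * (2 : ℝ) ^ m) := by
  have hmem : ∀ S, Sᶜ ∈ bases M.dual ↔ S ∈ bases M := fun S => by
    rw [mem_bases_dual hE, compl_compl]
  obtain ⟨S₀, hS₀⟩ := bases_nonempty M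
  have hnm : n ≤ m := by
    rw [← hn S₀ hS₀]
    exact (Finset.card_le_univ _).trans (by simp)
  -- The least weight `μ T` serves as `b`, and `a = P * μ T` bounds all weights, so that `a / b =
  -- P`.
  obtain ⟨T, hT, hmin⟩ := Finset.exists_min_image (bases M.dual) μ (bases_nonempty _)
  have hb := hpos T hT
  have hP0 : 0 ≤ P := by
    have := hP T hT T hT
    rw [div_self hb.ne'] at this
    linarith
  have hhd : (genPoly μ).IsHomogeneous (m - n) := isHomogeneous_genPoly fun S hS => by
    by_contra hcard
    refine hS (hzero S fun hSm => hcard ?_)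
    have := hn _ ((mem_bases_dual hE).1 hSm)
    rw [Finset.card_compl, Fintype.card_fin] at this
    have h2 := Finset.card_le_univ S
    rw [Fintype.card_fin] at h2
    omega
  have key : ∀ θ ∈ basePolytope (bases M), ∀ c : ℝ, 0 < c →
      (∀ z : Fin m → ℝ, (∀ i, 0 < z i) → c * ∏ i, z i ^ θ i ≤ eval z g) →
      c ≤ (P * μ T) / μ T * ((m : ℝ) ^ m / m.factorial) * famCoeff (bases M) g ∧
      ((∀ i, degreeOf i g ≤ 1) → (∀ i, degreeOf i (genPoly μ) ≤ 1) →
        c ≤ (P * μ T) / μ T * 2 ^ m * famCoeff (bases M) g) := by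
    intro θ hθ c hc hge
    refine le_famCoeff_of_selector hnm hg (hgs.hurwitzStable hgd) hgd hμ hhd hb ?_ ?_ ?_ hc hge
    · intro S hS
      rw [coeff_sqfreeExp_genPoly, ← div_le_iff₀ hb]
      exact hP _ ((hmem S).2 hS) _ hT
    · intro S hS
      rw [coeff_sqfreeExp_genPoly]
      exact hzero _ (fun h => hS ((hmem S).1 h))
    · intro z hz
      have hzp : ∀ S : Finset (Fin m), 0 < ∏ i ∈ S, z i := fun S =>
        Finset.prod_pos fun i _ => hz i
      calc μ T * ∏ i, z i ^ (1 - θ i) ≤ μ T * ∑ S ∈ bases M, ∏ i ∈ Sᶜ, z i :=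
            mul_le_mul_of_nonneg_left (prod_rpow_one_sub_le hθ hz) hb.le
        _ ≤ ∑ S ∈ bases M, μ Sᶜ * ∏ i ∈ Sᶜ, z i := by
            rw [Finset.mul_sum]
            exact Finset.sum_le_sum fun S hS =>
              mul_le_mul_of_nonneg_right (hmin _ ((hmem S).2 hS)) (hzp _).le
        _ ≤ ∑ S, μ Sᶜ * ∏ i ∈ Sᶜ, z i := by
            refine Finset.sum_le_sum_of_subset_of_nonneg (Finset.subset_univ _) fun S _ hS => ?_
            rw [hzero _ (fun h => hS ((hmem S).1 h)), zero_mul]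
        _ = ∑ S, μ S * ∏ i ∈ S, z i :=
            Equiv.sum_comp ⟨compl, compl, compl_compl, compl_compl⟩
              (fun S : Finset (Fin m) => μ S * ∏ i ∈ S, z i)
        _ = _ := (eval_genPoly μ z).symm
  have hPT : P * μ T / μ T = P := mul_div_cancel_right₀ _ hb.ne'
  rw [hPT] at key
  refine ⟨capacity_div_le ⟨S₀, hS₀⟩ hg hgB (by positivity) fun θ hθ c hc hge =>
    (key θ hθ c hc hge).1, fun hma => capacity_div_le ⟨S₀, hS₀⟩ hg hgB (by positivity)
    fun θ hθ c hc hge => (key θ hθ c hc hge).2 hma.degreeOf_le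
      (multiaffine_genPoly μ).degreeOf_le⟩

lemma approxRatio_le {m n : ℕ} {B : Finset (Finset (Fin m))} {K : ℝ}
    (h : ∀ g : MvPolynomial (Fin m) ℝ, NonnegCoeffs g → RealStable g → g.IsHomogeneous n →
      0 < famCoeff B g → capacity B g / famCoeff B g ≤ K) : approxRatio n B ≤ (K : EReal) := by
  refine sSup_le ?_
  rintro _ ⟨g, h1, h2, h3, h4, rfl⟩
  exact EReal.coe_le_coe_iff.2 (h g h1 h2 h3 h4)

lemma approxRatioLin_le {m n : ℕ} {B : Finset (Finset (Fin m))} {K : ℝ}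
    (h : ∀ g : MvPolynomial (Fin m) ℝ, NonnegCoeffs g → Multiaffine g → RealStable g →
      g.IsHomogeneous n → 0 < famCoeff B g → capacity B g / famCoeff B g ≤ K) :
    approxRatioLin n B ≤ (K : EReal) := by
  refine sSup_le ?_
  rintro _ ⟨g, h1, h2, h3, h4, h5, rfl⟩
  exact EReal.coe_le_coe_iff.2 (h g h1 h2 h3 h4 h5)

/-! ### Cauchy–Binet expansion. -/

/-- Expansion of `det (Vᵀ diag(z) V)` by multilinearity in the rows. -/
lemma det_transpose_mul_diagonal_mul {m d : ℕ} {R : Type*} [CommRing R]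
    (V : Matrix (Fin m) (Fin d) R) (z : Fin m → R) :
    (V.transpose * Matrix.diagonal z * V).det =
      ∑ φ : Fin d → Fin m, ((∏ i, V (φ i) i) * (V.submatrix φ id).det) * ∏ i, z (φ i) := by
  have h1 : V.transpose * Matrix.diagonal z * V =
      fun i => ∑ k, (V k i * z k) • V k := by
    funext i j
    rw [Matrix.mul_apply]
    simp [Matrix.mul_diagonal, Finset.sum_apply]
  rw [h1]
  have h2 := (Matrix.detRowAlternating (n := Fin d) (R := R)).toMultilinearMap.map_sum
    (g := fun i k => (V k i * z k) • V k)
  have h3 : ∀ A : Fin d → Fin d → R,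
    (Matrix.detRowAlternating (n := Fin d) (R := R)).toMultilinearMap A = Matrix.det A :=
    fun A => rfl
  rw [h3] at h2
  refine h2.trans (Finset.sum_congr rfl fun φ _ => ?_)
  rw [MultilinearMap.map_smul_univ, h3, smul_eq_mul, Finset.prod_mul_distrib]
  have : (fun i => V (φ i)) = V.submatrix φ id := rfl
  rw [this]
  ring

lemma rowDet_eq {m d : ℕ} (V : Matrix (Fin m) (Fin d) ℝ) (S : Finset (Fin m)) :
    rowDet V S = (V.transpose * Matrix.diagonal (fun i => if i ∈ S then (1 : ℝ) else 0) * V).det := by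
  unfold rowDet rowSubmatrix
  congr 1
  ext i j
  rw [Matrix.mul_apply, Matrix.mul_apply]
  simp only [Matrix.transpose_apply, Matrix.submatrix_apply, id,
    Matrix.mul_diagonal, mul_ite, mul_one, mul_zero, ite_mul, zero_mul]
  rw [Finset.sum_ite_mem, Finset.univ_inter]
  exact Finset.sum_coe_sort S (fun k => V k i * V k j)

lemma det_submatrix_eq_zero {m d : ℕ} (V : Matrix (Fin m) (Fin d) ℝ) {φ : Fin d → Fin m}
    (hφ : ¬ Function.Injective φ) : (V.submatrix φ id).det = 0 := by
  rw [Function.Injective] at hφ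
  push Not at hφ
  obtain ⟨i, j, hij, hne⟩ := hφ
  exact Matrix.det_zero_of_row_eq hne (by funext k; simp [hij])

/-- The row expansion at `z = 1_S`: only injective `φ` with image inside `S` survive, and then the
image is `S` because `S` has `d` elements. -/
lemma rowDet_eq_sum {m d : ℕ} (V : Matrix (Fin m) (Fin d) ℝ) {S : Finset (Fin m)}
    (hS : S.card = d) :
    rowDet V S = ∑ φ : Fin d → Fin m with Finset.univ.image φ = S,
      (∏ i, V (φ i) i) * (V.submatrix φ id).det := by
  rw [rowDet_eq, det_transpose_mul_diagonal_mul, Finset.sum_filter]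
  refine Finset.sum_congr rfl fun φ _ => ?_
  by_cases hφ : Function.Injective φ
  · by_cases himg : Finset.univ.image φ = S
    · have : ∏ i, (if φ i ∈ S then (1 : ℝ) else 0) = 1 := Finset.prod_eq_one fun i _ =>
        if_pos (himg ▸ Finset.mem_image_of_mem _ (Finset.mem_univ _))
      rw [if_pos himg, this, mul_one]
    · rw [if_neg himg]
      have : ∃ i, φ i ∉ S := by
        by_contra! hall
        refine himg (Finset.eq_of_subset_of_card_le (fun x hx => ?_) ?_)
        · obtain ⟨i, -, rfl⟩ := Finset.mem_image.1 hx
          exact hall i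
        · rw [Finset.card_image_of_injective _ hφ, hS]
          simp
      obtain ⟨i, hi⟩ := this
      have : ∏ i, (if φ i ∈ S then (1 : ℝ) else 0) = 0 :=
        Finset.prod_eq_zero (Finset.mem_univ i) (if_neg hi)
      rw [this, mul_zero]
  · rw [det_submatrix_eq_zero V hφ]
    simp

/-- The **Cauchy–Binet** expansion of `det (Vᵀ diag(z) V)` at complex `z`. -/
lemma det_eq_sum_rowDet {m d : ℕ} (V : Matrix (Fin m) (Fin d) ℝ) (z : Fin m → ℂ) :
    ((V.map Complex.ofReal).transpose * Matrix.diagonal z * V.map Complex.ofReal).det =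
      ∑ S : Finset (Fin m), ((if S.card = d then rowDet V S else 0 : ℝ) : ℂ) * ∏ i ∈ S, z i := by
  rw [det_transpose_mul_diagonal_mul,
    ← Finset.sum_fiberwise (s := Finset.univ) (g := fun φ : Fin d → Fin m => Finset.univ.image φ)]
  refine Finset.sum_congr rfl fun S _ => ?_
  have hdet : ∀ φ : Fin d → Fin m, ((V.map Complex.ofReal).submatrix φ id).det =
      (((V.submatrix φ id).det : ℝ) : ℂ) := fun φ =>
    (RingHom.map_det Complex.ofRealHom (V.submatrix φ id)).symm
  by_cases hS : S.card = d
  · rw [if_pos hS, rowDet_eq_sum V hS, Complex.ofReal_sum, Finset.sum_mul]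
    refine Finset.sum_congr rfl fun φ hφ => ?_
    rw [Finset.mem_filter] at hφ
    have hinj : Function.Injective φ := by
      have := Finset.card_image_iff (s := Finset.univ) (f := φ)
      rw [hφ.2, hS, Finset.card_univ, Fintype.card_fin] at this
      simpa [Set.injOn_univ] using this.1 rfl
    rw [hdet]
    have : ∏ i ∈ S, z i = ∏ i, z (φ i) := by
      rw [← hφ.2, Finset.prod_image (fun a _ b _ h => hinj h)]
    rw [this]
    push_cast
    rfl
  · rw [if_neg hS, Complex.ofReal_zero, zero_mul]
    refine Finset.sum_eq_zero fun φ hφ => ?_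
    rw [Finset.mem_filter] at hφ
    have hinj : ¬ Function.Injective φ := fun hinj => hS (by
      rw [← hφ.2, Finset.card_image_of_injective _ hinj]; simp)
    rw [hdet, det_submatrix_eq_zero V hinj]
    simp

lemma rowDet_eq_sq {m d : ℕ} (V : Matrix (Fin m) (Fin d) ℝ) {S : Finset (Fin m)}
    (e : Fin d ≃ {i // i ∈ S}) :
    rowDet V S = ((V.submatrix (fun k => (e k).1) id).det) ^ 2 := by
  have h : V.submatrix (fun k => (e k).1) id = (rowSubmatrix V S).submatrix e id := rfl
  unfold rowDet
  have hsq : ∀ A : Matrix (Fin d) (Fin d) ℝ, A.det ^ 2 = (A.transpose * A).det := fun A => by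
    rw [Matrix.det_mul, Matrix.det_transpose, sq]
  rw [h, hsq, Matrix.transpose_submatrix, Matrix.submatrix_mul_equiv]
  simp

/-! ### Represented matroids: stability of the determinant polynomial, and duality. -/

section Representation

variable {m d : ℕ} {N : Matroid (Fin m)} {V : Matrix (Fin m) (Fin d) ℝ}

lemma IsRepresentation.indep_iff (hV : IsRepresentation N V) (S : Set (Fin m)) :
    N.Indep S ↔ LinearIndepOn ℝ (fun i => V i) S := by
  classical
  have := hV (Set.toFinite S).toFinset
  rw [Set.Finite.coe_toFinset] at this
  rw [this]
  have h2 : LinearIndepOn ℝ (fun i => V i) S ↔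
      LinearIndepOn ℝ (fun i => V i) ((Set.toFinite S).toFinset : Set (Fin m)) := by
    rw [Set.Finite.coe_toFinset]
  rw [h2]
  rfl

lemma IsRepresentation.mem_span_of_not_indep_insert (hV : IsRepresentation N V)
    {I : Set (Fin m)} (hI : N.Indep I) {i : Fin m} (hi : i ∈ I ∨ ¬ N.Indep (insert i I)) :
    V i ∈ Submodule.span ℝ ((fun i => V i) '' I) := by
  by_cases hiI : i ∈ I
  · exact Submodule.subset_span ⟨i, hiI, rfl⟩
  · have h := hi.resolve_left hiI
    rw [hV.indep_iff, linearIndepOn_insert hiI] at h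
    by_contra hcon
    exact h ⟨(hV.indep_iff I).1 hI, hcon⟩

lemma IsRepresentation.mem_span_base (hV : IsRepresentation N V) (hE : N.E = Set.univ)
    {B : Set (Fin m)} (hB : N.IsBase B) (i : Fin m) :
    V i ∈ Submodule.span ℝ ((fun i => V i) '' B) := by
  refine hV.mem_span_of_not_indep_insert hB.indep ?_
  by_cases hi : i ∈ B
  · exact Or.inl hi
  · exact Or.inr (hB.insert_dep ⟨by rw [hE]; trivial, hi⟩).not_indep

lemma card_of_mem_bases (hr : N.eRank = (d : ℕ∞)) {S : Finset (Fin m)} (hS : S ∈ bases N) :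
    S.card = d := by
  have := (mem_bases.1 hS).encard_eq_eRank
  rw [hr, Set.encard_coe_eq_coe_finsetCard] at this
  exact_mod_cast this

lemma IsRepresentation.det_ne_zero_iff (hV : IsRepresentation N V)
    {S : Finset (Fin m)} (e : Fin d ≃ {i // i ∈ S}) :
    (V.submatrix (fun k => (e k).1) id).det ≠ 0 ↔ N.Indep (S : Set (Fin m)) := by
  rw [hV S, ← isUnit_iff_ne_zero, ← Matrix.isUnit_iff_isUnit_det,
    ← Matrix.linearIndependent_rows_iff_isUnit,
    ← linearIndependent_equiv e (f := fun i : {i // i ∈ S} => V i.1)]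
  rfl

lemma IsRepresentation.rowDet_pos (hV : IsRepresentation N V) (hr : N.eRank = (d : ℕ∞))
    {S : Finset (Fin m)} (hS : S ∈ bases N) : 0 < rowDet V S := by
  have e : Fin d ≃ {i // i ∈ S} :=
    (Finset.equivFinOfCardEq (card_of_mem_bases hr hS)).symm
  rw [rowDet_eq_sq V e]
  exact sq_pos_iff.2 ((hV.det_ne_zero_iff e).2 (mem_bases.1 hS).indep)

lemma IsRepresentation.rowDet_eq_zero (hV : IsRepresentation N V) (hr : N.eRank = (d : ℕ∞))
    {S : Finset (Fin m)} (hcard : S.card = d) (hS : S ∉ bases N) : rowDet V S = 0 := by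
  have e : Fin d ≃ {i // i ∈ S} := (Finset.equivFinOfCardEq hcard).symm
  rw [rowDet_eq_sq V e]
  by_contra h
  have hi := (hV.det_ne_zero_iff e).1 (fun h0 => h (by rw [h0]; ring))
  refine hS (mem_bases.2 (hi.isBase_of_eRk_ge (Set.toFinite _) ?_))
  rw [hr, hi.eRk_eq_encard, Set.encard_coe_eq_coe_finsetCard, hcard]

/-- The weight `det (V_Sᵀ V_S)` on the bases of a represented matroid. -/
def baseWeight (N : Matroid (Fin m)) (V : Matrix (Fin m) (Fin d) ℝ) (S : Finset (Fin m)) : ℝ :=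
  open Classical in if S ∈ bases N then rowDet V S else 0

/-- By Cauchy–Binet this is `det(Vᵀ diag(z) V)`. A kernel vector `v` would give `∑ Re(z_i) |(V
v)_i|² = 0`, hence `V v = 0`, and `v = 0` because the rows of a basis form an invertible matrix. -/
lemma IsRepresentation.hurwitzStable_baseWeight (hV : IsRepresentation N V)
    (hr : N.eRank = (d : ℕ∞)) : HurwitzStable (genPoly (baseWeight N V)) := by
  intro z hz h0
  rw [aeval_genPoly] at h0
  have hw : ∀ S, baseWeight N V S = if S.card = d then rowDet V S else 0 := by
    intro S
    unfold baseWeight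
    by_cases hS : S ∈ bases N
    · rw [if_pos hS, if_pos (card_of_mem_bases hr hS)]
    · rw [if_neg hS]
      split_ifs with hcard
      · exact (hV.rowDet_eq_zero hr hcard hS).symm
      · rfl
  simp_rw [hw] at h0
  rw [← det_eq_sum_rowDet] at h0
  set W := V.map Complex.ofReal with hW
  obtain ⟨v, hv0, hv⟩ := Matrix.exists_mulVec_eq_zero_iff.2 h0
  refine hv0 ?_
  have hWs : W.transpose = W.conjTranspose := by
    ext i j
    simp [hW]
  have h1 : star (W.mulVec v) ⬝ᵥ ((Matrix.diagonal z).mulVec (W.mulVec v)) = 0 := by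
    rw [Matrix.star_mulVec, ← hWs, Matrix.dotProduct_mulVec, Matrix.vecMul_vecMul,
      Matrix.dotProduct_mulVec, Matrix.vecMul_vecMul, ← Matrix.dotProduct_mulVec, hv,
      dotProduct_zero]
  have h2 : ∑ i, (z i).re * Complex.normSq (W.mulVec v i) = 0 := by
    have := congrArg Complex.re h1
    rw [dotProduct, Complex.re_sum, Complex.zero_re] at this
    rw [← this]
    refine Finset.sum_congr rfl fun i _ => ?_
    rw [Matrix.mulVec_diagonal, Pi.star_apply]
    have : star (W.mulVec v i) * (z i * W.mulVec v i) =
        z i * (Complex.normSq (W.mulVec v i) : ℂ) := by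
      rw [← Complex.mul_conj]
      simp only [Complex.star_def]
      ring
    rw [this, Complex.re_mul_ofReal]
  have h3 : ∀ i, W.mulVec v i = 0 := by
    intro i
    have := (Finset.sum_eq_zero_iff_of_nonneg (fun i _ =>
      mul_nonneg (hz i).le (Complex.normSq_nonneg _))).1 h2 i (Finset.mem_univ i)
    rcases mul_eq_zero.1 this with h | h
    · exact absurd h (hz i).ne'
    · exact Complex.normSq_eq_zero.1 h
  obtain ⟨S, hS⟩ := bases_nonempty N
  have e : Fin d ≃ {i // i ∈ S} :=
    (Finset.equivFinOfCardEq (card_of_mem_bases hr hS)).symm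
  have hdet := (hV.det_ne_zero_iff e).2 (mem_bases.1 hS).indep
  have hdet' : ((V.submatrix (fun k => (e k).1) id).map Complex.ofReal).det ≠ 0 := by
    have := RingHom.map_det Complex.ofRealHom (V.submatrix (fun k => (e k).1) id)
    intro h
    refine hdet ?_
    have h5 : ((V.submatrix (fun k => (e k).1) id).det : ℂ) = 0 := this.trans h
    exact_mod_cast h5
  refine Matrix.eq_zero_of_mulVec_eq_zero hdet' ?_
  funext k
  exact h3 (e k).1

lemma div_le_matrixUnbalance (B : Finset (Finset (Fin m))) (V : Matrix (Fin m) (Fin d) ℝ)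
    {S T : Finset (Fin m)} (hS : S ∈ B) (hT : T ∈ B) :
    rowDet V S / rowDet V T ≤ matrixUnbalance B V := by
  refine le_csSup (Set.Finite.bddAbove ?_) ⟨S, hS, T, hT, rfl⟩
  refine ((B ×ˢ B).finite_toSet.image fun p => rowDet V p.1 / rowDet V p.2).subset ?_
  rintro _ ⟨S, hS, T, hT, rfl⟩
  exact ⟨(S, T), by simp [hS, hT], rfl⟩

lemma IsRepresentation.eRank_eq (hV : IsRepresentation N V) (hE : N.E = Set.univ)
    (hspan : Submodule.span ℝ (Set.range fun i => V i) = ⊤) : N.eRank = (d : ℕ∞) := by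
  obtain ⟨S, hS⟩ := bases_nonempty N
  have hB := mem_bases.1 hS
  rw [← hB.encard_eq_eRank, Set.encard_coe_eq_coe_finsetCard]
  have hli := (hV S).1 hB.indep
  have htop : Submodule.span ℝ (Set.range fun i : {i // i ∈ S} => V i.1) = ⊤ := by
    rw [eq_top_iff, ← hspan, Submodule.span_le]
    rintro _ ⟨i, rfl⟩
    have := hV.mem_span_base hE hB i
    have himg : (fun i => V i) '' (S : Set (Fin m)) =
        Set.range fun i : {i // i ∈ S} => V i.1 := by
      ext x
      simp
    rwa [himg] at this
  have := Module.finrank_eq_card_basis (Module.Basis.mk hli htop.ge)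
  simp at this
  rw [← this]

/-- The dual of a real-linear matroid is real-linear: the rows of a representation of the dual are
the images of the unit vectors in the quotient by the column space. -/
theorem IsRepresentation.exists_dual (hV : IsRepresentation N V) (hE : N.E = Set.univ) :
    ∃ (k : ℕ) (V' : Matrix (Fin m) (Fin k) ℝ), N.dual.eRank = (k : ℕ∞) ∧
      IsRepresentation N.dual V' := by
  classical
  set L := LinearMap.range V.mulVecLin with hL
  set b := Module.finBasis ℝ ((Fin m → ℝ) ⧸ L)
  set π : (Fin m → ℝ) →ₗ[ℝ] (Fin (Module.finrank ℝ ((Fin m → ℝ) ⧸ L)) → ℝ) :=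
    b.equivFun.toLinearMap.comp L.mkQ with hπ
  have hπ0 : ∀ y, π y = 0 ↔ y ∈ L := by
    intro y
    simp [hπ]
  have hsurj : Function.Surjective π := by
    rw [hπ, LinearMap.coe_comp]
    exact b.equivFun.surjective.comp L.mkQ_surjective
  set V' : Matrix (Fin m) (Fin (Module.finrank ℝ ((Fin m → ℝ) ⧸ L))) ℝ :=
    fun i => π (Pi.single i 1) with hV'
  have hrep : IsRepresentation N.dual V' := by
    intro S
    -- A linear dependence among the rows of `V'` in `S` is a vector `V x` of the column space
    -- supported in `S`. Independence thus means that the rows of `V` outside `S` already span all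
    -- rows, that is, that the complement of `S` contains a basis.
    have hiff : LinearIndependent ℝ (fun i : {i // i ∈ S} => V' i.1) ↔
        ∀ x : Fin d → ℝ, (∀ i ∉ S, V i ⬝ᵥ x = 0) → ∀ i, V i ⬝ᵥ x = 0 := by
      rw [Fintype.linearIndependent_iff]
      constructor
      · intro h x hx i
        by_cases hi : i ∈ S
        · refine h (fun i => V i.1 ⬝ᵥ x) ?_ ⟨i, hi⟩
          have : V.mulVec x = ∑ i : {i // i ∈ S}, (V i.1 ⬝ᵥ x) • Pi.single (M := fun _ => ℝ) i.1 1 := by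
            rw [Finset.sum_coe_sort S (fun i => (V i ⬝ᵥ x) • Pi.single (M := fun _ => ℝ) i 1)]
            funext k
            rw [Finset.sum_apply]
            simp only [Pi.smul_apply, Pi.single_apply, smul_eq_mul, mul_ite, mul_one, mul_zero]
            rw [Finset.sum_ite_eq]
            split_ifs with hk
            · rfl
            · exact hx k hk
          have h2 := (hπ0 (V.mulVec x)).2 ⟨x, rfl⟩
          rw [this, map_sum] at h2
          simpa only [map_smul] using h2
        · exact hx i hi
      · intro h c hc i
        set y : Fin m → ℝ := ∑ i : {i // i ∈ S}, c i • Pi.single (M := fun _ => ℝ) i.1 1 with hy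
        have hyc : ∀ k (hk : k ∈ S), y k = c ⟨k, hk⟩ := by
          intro k hk
          rw [hy, Finset.sum_apply, Finset.sum_eq_single ⟨k, hk⟩]
          · simp
          · intro j _ hj
            have : k ≠ j.1 := fun h => hj (Subtype.ext h.symm)
            simp [this]
          · simp
        have hyn : ∀ k ∉ S, y k = 0 := by
          intro k hk
          rw [hy, Finset.sum_apply]
          refine Finset.sum_eq_zero fun j _ => ?_
          have : k ≠ j.1 := fun h => hk (h ▸ j.2)
          simp [this]
        have hyL : y ∈ L := by
          rw [← hπ0, hy, map_sum]
          simpa only [map_smul] using hc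
        obtain ⟨x, hx⟩ := hyL
        have hx' : ∀ k, V k ⬝ᵥ x = y k := fun k => congrFun hx k
        have := h x (fun k hk => by rw [hx', hyn k hk]) i.1
        rw [hx', hyc i.1 i.2] at this
        exact this
    rw [hiff, N.dual_indep_iff_exists (by rw [hE]; exact Set.subset_univ _)]
    constructor
    · rintro ⟨B, hB, hdisj⟩ x hx i
      have hle : Submodule.span ℝ ((fun i => V i) '' B) ≤
          LinearMap.ker (dotProductBilin ℝ ℝ |>.flip x : (Fin d → ℝ) →ₗ[ℝ] ℝ) := by
        rw [Submodule.span_le]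
        rintro _ ⟨j, hj, rfl⟩
        have := hx j (fun hjS => Set.disjoint_left.1 hdisj hjS hj)
        simpa using this
      have := hle (hV.mem_span_base hE hB i)
      simpa using this
    · intro h
      obtain ⟨B, hB⟩ := N.exists_isBasis ((S : Set (Fin m))ᶜ) (by rw [hE]; exact Set.subset_univ _)
      refine ⟨B, ?_, Set.disjoint_left.2 fun j hj hjB => hB.subset hjB hj⟩
      have hspanc : ∀ j ∉ S, V j ∈ Submodule.span ℝ ((fun i => V i) '' B) := by
        intro j hj
        refine hV.mem_span_of_not_indep_insert hB.indep ?_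
        by_cases hjB : j ∈ B
        · exact Or.inl hjB
        · exact Or.inr (hB.insert_dep ⟨hj, hjB⟩).not_indep
      have hspan : ∀ j, V j ∈ Submodule.span ℝ ((fun i => V i) '' B) := by
        intro j
        by_contra hj
        -- A functional vanishing on the span of `B` but not at row `j` is given by a vector `x`
        -- that contradicts `h`.
        obtain ⟨f, hfj, hf⟩ := Submodule.exists_le_ker_of_notMem hj
        have hfx : ∀ w, f w = w ⬝ᵥ fun k => f (Pi.single k 1) := by
          intro w
          have hw : w = ∑ k, w k • Pi.single (M := fun _ => ℝ) k 1 := by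
            funext l
            simp [Finset.sum_apply, Pi.single_apply]
          conv_lhs => rw [hw]
          rw [map_sum]
          simp [dotProduct]
        refine hfj ?_
        rw [hfx]
        refine h _ (fun i hi => ?_) j
        rw [← hfx]
        exact hf (hspanc i hi)
      refine hB.indep.isBase_of_forall_insert fun j hj hins => ?_
      rw [hV.indep_iff, linearIndepOn_insert hj.2] at hins
      exact hins.2 (hspan j)
  refine ⟨_, V', hrep.eRank_eq hE ?_, hrep⟩
  rw [eq_top_iff]
  intro w _
  obtain ⟨y, rfl⟩ := hsurj w
  have hy : y = ∑ k, y k • Pi.single (M := fun _ => ℝ) k 1 := by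
    funext l
    simp [Finset.sum_apply, Pi.single_apply]
  rw [hy, map_sum]
  refine Submodule.sum_mem _ fun k _ => ?_
  rw [map_smul]
  exact Submodule.smul_mem _ _ (Submodule.subset_span ⟨k, rfl⟩)

end Representation

/-- Both approximation bounds for real-linear matroids. -/
theorem capacity_div_le_of_isRealLinear {m n : ℕ} {M : Matroid (Fin m)} (hE : M.E = Set.univ)
    (hn : ∀ S ∈ bases M, S.card = n) (hM : IsRealLinear M)
    {g : MvPolynomial (Fin m) ℝ} (hg : NonnegCoeffs g) (hgs : RealStable g)
    (hgd : g.IsHomogeneous n) (hgB : 0 < famCoeff (bases M) g) :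
    capacity (bases M) g / famCoeff (bases M) g ≤
        unbalance M.dual * ((m : ℝ) ^ m / (m.factorial : ℝ)) ∧
      (Multiaffine g →
        capacity (bases M) g / famCoeff (bases M) g ≤ unbalance M.dual * (2 : ℝ) ^ m) := by
  obtain ⟨d, V, hV⟩ := hM
  obtain ⟨k₀, V₀, hr₀, hV₀⟩ := hV.exists_dual hE
  have hm : (0 : ℝ) < (m : ℝ) ^ m / (m.factorial : ℝ) := by
    rcases Nat.eq_zero_or_pos m with rfl | hm
    · simp
    · positivity
  have main : ∀ K : ℝ, 0 < K →
      (∀ (k : ℕ) (W : Matrix (Fin m) (Fin k) ℝ), M.dual.eRank = (k : ℕ∞) →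
        IsRepresentation M.dual W → capacity (bases M) g / famCoeff (bases M) g ≤
          matrixUnbalance (bases M.dual) W * K) →
      capacity (bases M) g / famCoeff (bases M) g ≤ unbalance M.dual * K := by
    intro K hK h
    rw [← div_le_iff₀ hK]
    -- The real infimum over an empty set would be 0, so a representation of the dual has to exist
    -- for this step.
    refine le_csInf ⟨_, k₀, V₀, hr₀, hV₀, rfl⟩ ?_
    rintro _ ⟨k, W, hr, hW, rfl⟩
    rw [div_le_iff₀ hK]
    exact h k W hr hW
  have key : ∀ (k : ℕ) (W : Matrix (Fin m) (Fin k) ℝ), M.dual.eRank = (k : ℕ∞) →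
      IsRepresentation M.dual W → _ := fun k W hr hW =>
    capacity_div_le_of_weight hE hn (μ := baseWeight M.dual W)
      (P := matrixUnbalance (bases M.dual) W)
      (fun S hS => by rw [baseWeight, if_pos hS]; exact hW.rowDet_pos hr hS)
      (fun S hS => by rw [baseWeight, if_neg hS])
      (hW.hurwitzStable_baseWeight hr)
      (fun S hS T hT => by
        rw [baseWeight, baseWeight, if_pos hS, if_pos hT]
        exact div_le_matrixUnbalance _ W hS hT) hg hgs hgd hgB
  exact ⟨main _ hm fun k W hr hW => (key k W hr hW).1,
    fun hma => main _ (by positivity) fun k W hr hW => (key k W hr hW).2 hma⟩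

/-! ### Partition matroids. -/

/-- The product of the `c j`-th powers of the sums of the variables in the blocks `P j`. -/
def blockPoly {m p : ℕ} (P : Fin p → Finset (Fin m)) (c : Fin p → ℕ) : MvPolynomial (Fin m) ℝ :=
  ∏ j, (∑ i ∈ P j, X i) ^ c j

lemma isHomogeneous_blockPoly {m p : ℕ} (P : Fin p → Finset (Fin m)) (c : Fin p → ℕ) :
    (blockPoly P c).IsHomogeneous (∑ j, c j) := by
  refine IsHomogeneous.prod _ _ _ fun j _ => ?_
  have : (∑ i ∈ P j, (X i : MvPolynomial (Fin m) ℝ)).IsHomogeneous 1 :=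
    IsHomogeneous.sum _ _ _ fun i _ => isHomogeneous_X ℝ i
  simpa using this.pow (c j)

lemma hurwitzStable_blockPoly {m p : ℕ} {P : Fin p → Finset (Fin m)} (c : Fin p → ℕ)
    (hP : ∀ j, (P j).Nonempty) : HurwitzStable (blockPoly P c) := by
  intro z hz
  unfold blockPoly
  rw [map_prod, Finset.prod_ne_zero_iff]
  intro j _
  rw [map_pow, map_sum]
  refine pow_ne_zero _ fun h => ?_
  have h1 := congrArg Complex.re h
  simp only [aeval_X, Complex.re_sum, Complex.zero_re] at h1
  exact (Finset.sum_pos (fun i _ => hz i) (hP j)).ne' h1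

lemma coeff_sqfreeExp_mul_X {m : ℕ} (f : MvPolynomial (Fin m) ℝ) (S : Finset (Fin m)) (i : Fin m) :
    coeff (sqfreeExp S) (f * X i) = if i ∈ S then coeff (sqfreeExp (S.erase i)) f else 0 := by
  classical
  rw [coeff_mul_X']
  have h1 : i ∈ (sqfreeExp S).support ↔ i ∈ S := by
    simp [Finsupp.mem_support_iff, sqfreeExp_apply]
  by_cases hi : i ∈ S
  · rw [if_pos (h1.2 hi), if_pos hi]
    congr 1
    ext k
    rw [Finsupp.tsub_apply, sqfreeExp_apply, sqfreeExp_apply, Finsupp.single_apply]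
    by_cases hk : i = k
    · subst hk; simp [hi]
    · simp [hk, Ne.symm hk]
  · rw [if_neg (fun h => hi (h1.1 h)), if_neg hi]

/-- A square-free monomial arises once for each way of assigning the elements of `S ∩ P j` to the `c
j` factors of its block. The induction peels off one linear factor, from which any element of `S ∩ P
j₀` can be chosen. -/
lemma coeff_sqfreeExp_blockPoly {m p : ℕ} {P : Fin p → Finset (Fin m)}
    (hdisj : ∀ i j, i ≠ j → Disjoint (P i) (P j)) (hcov : ∀ x, ∃ j, x ∈ P j)
    (c : Fin p → ℕ) (S : Finset (Fin m)) :
    coeff (sqfreeExp S) (blockPoly P c) =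
      if ∀ j, (S ∩ P j).card = c j then ∏ j, ((c j).factorial : ℝ) else 0 := by
  classical
  induction hN : ∑ j, c j generalizing c S with
  | zero =>
    have hc : ∀ j, c j = 0 := fun j => by
      simpa using (Finset.sum_eq_zero_iff.1 hN) j (Finset.mem_univ j)
    have h1 : (∀ j, (S ∩ P j).card = c j) ↔ S = ∅ := by
      constructor
      · intro h
        refine Finset.eq_empty_of_forall_notMem fun x hx => ?_
        obtain ⟨j, hj⟩ := hcov x
        have := h j
        rw [hc, Finset.card_eq_zero] at this
        exact Finset.notMem_empty x (this ▸ Finset.mem_inter.2 ⟨hx, hj⟩)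
      · rintro rfl j
        simp [hc]
    have h2 : blockPoly P c = 1 := by simp [blockPoly, hc]
    have h3 : (0 = sqfreeExp S) ↔ S = ∅ := by
      have : (0 : Fin m →₀ ℕ) = sqfreeExp ∅ := by simp [sqfreeExp]
      rw [this, sqfreeExp_injective.eq_iff, eq_comm]
    rw [h2, coeff_one, if_congr h1 rfl rfl, if_congr h3 rfl rfl]
    simp [hc]
  | succ N ih =>
    obtain ⟨j₀, hj₀⟩ : ∃ j, c j ≠ 0 := by
      by_contra! h
      simp [h] at hN
    obtain ⟨d, hd⟩ := Nat.exists_eq_succ_of_ne_zero hj₀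
    set c' := Function.update c j₀ d with hc'
    have hc'j : c' j₀ = d := by simp [hc']
    have hc'n : ∀ j, j ≠ j₀ → c' j = c j := fun j hj => by simp [hc', hj]
    have hsum : ∑ j, c' j = N := by
      have h1 := Finset.add_sum_erase Finset.univ c (Finset.mem_univ j₀)
      have h2 := Finset.add_sum_erase Finset.univ c' (Finset.mem_univ j₀)
      have h3 : ∑ j ∈ Finset.univ.erase j₀, c' j = ∑ j ∈ Finset.univ.erase j₀, c j :=
        Finset.sum_congr rfl fun j hj => hc'n j (Finset.ne_of_mem_erase hj)
      rw [hc'j, h3] at h2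
      omega
    have hpoly : blockPoly P c = ∑ i ∈ P j₀, blockPoly P c' * X i := by
      rw [← Finset.mul_sum]
      unfold blockPoly
      rw [← Finset.mul_prod_erase _ _ (Finset.mem_univ j₀),
        ← Finset.mul_prod_erase _ (fun j => (∑ i ∈ P j, X i) ^ c' j) (Finset.mem_univ j₀),
        hc'j, hd, pow_succ,
        Finset.prod_congr rfl fun j hj => by rw [← hc'n j (Finset.ne_of_mem_erase hj)]]
      ring
    have hfac : ∏ j, ((c j).factorial : ℝ) = (d + 1) * ∏ j, ((c' j).factorial : ℝ) := by
      rw [← Finset.mul_prod_erase _ _ (Finset.mem_univ j₀),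
        ← Finset.mul_prod_erase _ (fun j => ((c' j).factorial : ℝ)) (Finset.mem_univ j₀),
        hc'j, hd, Nat.factorial_succ,
        Finset.prod_congr rfl fun j hj => by rw [← hc'n j (Finset.ne_of_mem_erase hj)]]
      push_cast
      ring
    have hcond : ∀ i ∈ P j₀ ∩ S, (∀ j, (S.erase i ∩ P j).card = c' j) ↔
        ∀ j, (S ∩ P j).card = c j := by
      intro i hi
      rw [Finset.mem_inter] at hi
      refine forall_congr' fun j => ?_
      by_cases hj : j = j₀
      · subst hj
        have hmem : i ∈ S ∩ P j := Finset.mem_inter.2 ⟨hi.2, hi.1⟩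
        rw [hc'j, hd, Finset.erase_inter, Finset.card_erase_of_mem hmem]
        have := Finset.card_pos.2 ⟨i, hmem⟩
        omega
      · have hni : i ∉ S ∩ P j := fun h =>
          Finset.disjoint_left.1 (hdisj j j₀ hj) (Finset.mem_inter.1 h).2 hi.1
        rw [hc'n j hj, Finset.erase_inter, Finset.erase_eq_of_notMem hni]
    rw [hpoly, coeff_sum]
    simp_rw [coeff_sqfreeExp_mul_X]
    rw [Finset.sum_ite_mem, Finset.sum_congr rfl fun i hi => by
      rw [ih c' (S.erase i) hsum, if_congr (hcond i hi) rfl rfl]]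
    rw [Finset.sum_const, nsmul_eq_mul, hfac]
    split_ifs with h
    · have := h j₀
      rw [Finset.inter_comm, this, hd]
      push_cast
      ring
    · simp

/-- Weighted AM-GM for weights in `[0, 1]` with natural sum. -/
lemma pow_mul_prod_rpow_le {ι : Type*} (s : Finset ι) {η z : ι → ℝ} {c : ℕ}
    (h0 : ∀ i ∈ s, 0 ≤ η i) (h1 : ∀ i ∈ s, η i ≤ 1) (hsum : ∑ i ∈ s, η i = c)
    (hz : ∀ i ∈ s, 0 < z i) :
    (c : ℝ) ^ c * ∏ i ∈ s, z i ^ η i ≤ (∑ i ∈ s, z i) ^ c := by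
  rcases Nat.eq_zero_or_pos c with rfl | hc
  · rw [Nat.cast_zero, Finset.sum_eq_zero_iff_of_nonneg h0] at hsum
    rw [Finset.prod_eq_one fun i hi => by rw [hsum i hi, Real.rpow_zero]]
    simp
  · have hc0 : (0 : ℝ) < c := by exact_mod_cast hc
    have h := Real.geom_mean_le_arith_mean_weighted s (fun i => η i / c) z
      (fun i hi => div_nonneg (h0 i hi) hc0.le)
      (by rw [← Finset.sum_div, hsum, div_self hc0.ne']) (fun i hi => (hz i hi).le)
    have h2 : ∏ i ∈ s, z i ^ η i = (∏ i ∈ s, z i ^ (η i / c)) ^ c := by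
      rw [← Finset.prod_pow]
      refine Finset.prod_congr rfl fun i hi => ?_
      rw [← Real.rpow_natCast, ← Real.rpow_mul (hz i hi).le, div_mul_cancel₀ _ hc0.ne']
    rw [h2, ← mul_pow]
    refine pow_le_pow_left₀ (mul_nonneg hc0.le
      (Finset.prod_nonneg fun i hi => Real.rpow_nonneg (hz i hi).le _)) ?_ _
    calc (c : ℝ) * ∏ i ∈ s, z i ^ (η i / c) ≤ c * ∑ i ∈ s, η i / c * z i :=
          mul_le_mul_of_nonneg_left h hc0.le
      _ = ∑ i ∈ s, η i * z i := by
          rw [Finset.mul_sum]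
          exact Finset.sum_congr rfl fun i _ => by field_simp
      _ ≤ _ := Finset.sum_le_sum fun i hi => mul_le_of_le_one_left (hz i hi).le (h1 i hi)

lemma prod_univ_eq_prod_blocks {m p : ℕ} {R : Type*} [CommMonoid R] {P : Fin p → Finset (Fin m)}
    (hdisj : ∀ i j, i ≠ j → Disjoint (P i) (P j)) (hcov : ∀ x, ∃ j, x ∈ P j) (f : Fin m → R) :
    ∏ i, f i = ∏ j, ∏ i ∈ P j, f i := by
  classical
  rw [← Finset.prod_biUnion (fun i _ j _ h => hdisj i j h)]
  congr 1
  ext x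
  simpa using hcov x

section Partition

variable {m n p : ℕ} {M : Matroid (Fin m)} {P : Fin p → Finset (Fin m)} {b : Fin p → ℕ}

lemma IsPartitionMatroid.basePolytope_le (hM : IsPartitionMatroid M P b) {θ : Fin m → ℝ}
    (hθ : θ ∈ basePolytope (bases M)) :
    (∀ i, 0 ≤ θ i) ∧ (∀ i, θ i ≤ 1) ∧ ∀ j, ∑ i ∈ P j, θ i = b j := by
  have hlin : ∀ s : Finset (Fin m), IsLinearMap ℝ fun η : Fin m → ℝ => ∑ i ∈ s, η i :=
    fun s => ⟨fun x y => by simp [Finset.sum_add_distrib], fun r x => by simp [Finset.mul_sum]⟩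
  have hproj : ∀ i : Fin m, IsLinearMap ℝ fun η : Fin m → ℝ => η i :=
    fun i => ⟨fun x y => rfl, fun r x => rfl⟩
  refine ⟨fun i => ?_, fun i => ?_, fun j => ?_⟩
  · refine (convexHull_min ?_ (convex_halfSpace_ge (hproj i) 0) : basePolytope (bases M) ⊆ _) hθ
    rintro _ ⟨S, hS, rfl⟩
    simp only [charVec, Set.mem_ofPred_eq]
    split_ifs <;> norm_num
  · refine (convexHull_min ?_ (convex_halfSpace_le (hproj i) 1) : basePolytope (bases M) ⊆ _) hθ
    rintro _ ⟨S, hS, rfl⟩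
    simp only [charVec, Set.mem_ofPred_eq]
    split_ifs <;> norm_num
  · refine (convexHull_min ?_ (convex_hyperplane (hlin (P j)) (b j)) :
      basePolytope (bases M) ⊆ _) hθ
    rintro _ ⟨S, hS, rfl⟩
    have := (hM.isBase_iff S).1 (mem_bases.1 hS) j
    simp only [charVec, Set.mem_ofPred_eq]
    rw [← this, Finset.sum_ite_mem, Finset.inter_comm]
    simp

lemma IsPartitionMatroid.sum_card (hM : IsPartitionMatroid M P b) : ∑ j, (P j).card = m := by
  classical
  rw [← Finset.card_biUnion (fun i _ j _ h => hM.disjoint i j h)]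
  have : Finset.univ.biUnion P = Finset.univ := by
    ext x
    simpa using hM.cover x
  rw [this]
  simp

lemma IsPartitionMatroid.sum_eq (hM : IsPartitionMatroid M P b)
    (hn : ∀ S ∈ bases M, S.card = n) : ∑ j, b j = n := by
  classical
  obtain ⟨S, hS⟩ := bases_nonempty M
  rw [← hn S hS]
  have h := (hM.isBase_iff S).1 (mem_bases.1 hS)
  rw [← Finset.sum_congr rfl fun j _ => h j, ← Finset.card_biUnion fun i _ j _ hij =>
    (hM.disjoint i j hij).mono Finset.inter_subset_right Finset.inter_subset_right]
  congr 1
  ext x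
  have := hM.cover x
  simp [this]

/-- The bound on the approximation ratio for partition matroids. -/
theorem IsPartitionMatroid.capacity_div_le (hM : IsPartitionMatroid M P b)
    (hn : ∀ S ∈ bases M, S.card = n)
    {g : MvPolynomial (Fin m) ℝ} (hg : NonnegCoeffs g) (hgs : RealStable g)
    (hgd : g.IsHomogeneous n) (hgB : 0 < famCoeff (bases M) g) :
    capacity (bases M) g / famCoeff (bases M) g ≤ (m : ℝ) ^ m / (m.factorial : ℝ) *
      ∏ j, ((((P j).card - b j).factorial : ℝ) /
        (((P j).card - b j : ℕ) : ℝ) ^ ((P j).card - b j)) := by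
  classical
  set c : Fin p → ℕ := fun j => (P j).card - b j with hc
  have hsumc : ∑ j, c j = m - n := by
    have h1 := Finset.sum_tsub_distrib (f := fun j => (P j).card) (g := b) Finset.univ
      fun j _ => hM.le_card j
    rw [hM.sum_card, hM.sum_eq hn] at h1
    exact h1
  have hnm : n ≤ m := by
    refine le_of_eq_of_le (hM.sum_eq hn).symm (le_of_le_of_eq ?_ hM.sum_card)
    exact Finset.sum_le_sum fun j _ => hM.le_card j
  have hcpos : ∀ j, (0 : ℝ) < (c j : ℝ) ^ c j := fun j => by
    rcases Nat.eq_zero_or_pos (c j) with h | h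
    · simp [h]
    · positivity
  have hmem : ∀ S, (∀ j, (Sᶜ ∩ P j).card = c j) ↔ S ∈ bases M := by
    intro S
    rw [mem_bases, hM.isBase_iff]
    refine forall_congr' fun j => ?_
    have h1 : Sᶜ ∩ P j = P j \ S := by
      ext x
      simp [and_comm]
    have h2 := Finset.card_sdiff_add_card_inter (P j) S
    rw [h1]
    rw [Finset.inter_comm] at h2
    have h3 := hM.le_card j
    simp only [hc]
    omega
  refine BCapacity.capacity_div_le (bases_nonempty M) hg hgB (by positivity)
    fun θ hθ C hC hge => ?_
  obtain ⟨hθ0, hθ1, hθs⟩ := hM.basePolytope_le hθ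
  -- Each selected coefficient equals `∏ c_j!`. The lower bound `∏ c_j^{c_j}` is weighted AM-GM in
  -- each block with weights `(1 - θ_i)/c_j`, as `1 - θ` sums to `c_j` over `P j`.
  have h := (le_famCoeff_of_selector hnm (B := bases M) (h := blockPoly P c)
    (a := ∏ j, ((c j).factorial : ℝ)) (b := ∏ j, (c j : ℝ) ^ c j) hg (hgs.hurwitzStable hgd) hgd
    (hurwitzStable_blockPoly c hM.nonempty) (hsumc ▸ isHomogeneous_blockPoly P c)
    (Finset.prod_pos fun j _ => hcpos j)
    (fun S hS => by
      rw [coeff_sqfreeExp_blockPoly hM.disjoint hM.cover, if_pos ((hmem S).2 hS)])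
    (fun S hS => by
      rw [coeff_sqfreeExp_blockPoly hM.disjoint hM.cover,
        if_neg fun h => hS ((hmem S).1 h)])
    (fun z hz => by
      rw [prod_univ_eq_prod_blocks hM.disjoint hM.cover, ← Finset.prod_mul_distrib]
      unfold blockPoly
      rw [map_prod]
      refine Finset.prod_le_prod (fun j _ => mul_nonneg (hcpos j).le
        (Finset.prod_nonneg fun i _ => Real.rpow_nonneg (hz i).le _)) fun j _ => ?_
      rw [map_pow, map_sum]
      simp only [eval_X]
      refine pow_mul_prod_rpow_le (P j) (fun i _ => by linarith [hθ1 i])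
        (fun i _ => by linarith [hθ0 i]) ?_ fun i _ => hz i
      rw [Finset.sum_sub_distrib, hθs j, hc]
      simp [Nat.cast_sub (hM.le_card j)]) hC hge).1
  calc C ≤ _ := h
    _ = _ := by rw [← Finset.prod_div_distrib]; ring

lemma Multiaffine.eq_genPoly {g : MvPolynomial (Fin m) ℝ} (hg : Multiaffine g) :
    g = genPoly fun S => coeff (sqfreeExp S) g := by
  ext α
  by_cases hα : ∀ i, α i ≤ 1
  · rw [eq_sqfreeExp hα, coeff_sqfreeExp_genPoly]
  · have h1 : ∀ f : MvPolynomial (Fin m) ℝ, Multiaffine f → coeff α f = 0 := fun f hf => by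
      by_contra h
      exact hα (hf α (mem_support_iff.2 h))
    rw [h1 _ hg, h1 _ (multiaffine_genPoly _)]

/-- The bound on the approximation ratio over multiaffine polynomials for partition matroids. -/
theorem IsPartitionMatroid.capacity_div_le_of_multiaffine (hM : IsPartitionMatroid M P b)
    (hn : ∀ S ∈ bases M, S.card = n)
    {g : MvPolynomial (Fin m) ℝ} (hg : NonnegCoeffs g) (hma : Multiaffine g) (hgs : RealStable g)
    (hgd : g.IsHomogeneous n) (hgB : 0 < famCoeff (bases M) g) :
    capacity (bases M) g / famCoeff (bases M) g ≤ (n : ℝ) ^ n / (n.factorial : ℝ) *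
      ∏ j, (((b j).factorial : ℝ) / (b j : ℝ) ^ (b j)) := by
  classical
  refine BCapacity.capacity_div_le (bases_nonempty M) hg hgB (by positivity)
    fun θ hθ a ha hge => ?_
  obtain ⟨hθ0, hθ1, hθs⟩ := hM.basePolytope_le hθ
  choose J hJ using hM.cover
  have hPJ : ∀ j i, i ∈ P j ↔ J i = j := by
    intro j i
    constructor
    · intro h
      by_contra hne
      exact Finset.disjoint_left.1 (hM.disjoint _ _ hne) (hJ i) h
    · rintro rfl
      exact hJ i
  have hcardσ : Fintype.card (Σ j, Fin (b j)) = n := by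
    rw [Fintype.card_sigma]
    simpa using hM.sum_eq hn
  set e : (Σ j, Fin (b j)) ≃ Fin n := Fintype.equivFinOfCardEq hcardσ
  -- The `n` new variables are divided into blocks of sizes `b j`; every old variable in `P j` is
  -- then replaced by the average of the new variables in `Q j`.
  set Q : Fin p → Finset (Fin n) := fun j => Finset.univ.filter fun k => (e.symm k).1 = j with hQ
  have hQdisj : ∀ i j, i ≠ j → Disjoint (Q i) (Q j) := fun i j hij =>
    Finset.disjoint_left.2 fun k hk hk' => hij (by
      rw [← (Finset.mem_filter.1 hk).2, (Finset.mem_filter.1 hk').2])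
  have hQcov : ∀ k, ∃ j, k ∈ Q j := fun k => ⟨(e.symm k).1, by simp [hQ]⟩
  have hQcard : ∀ j, (Q j).card = b j := by
    intro j
    have h1 : Q j = Finset.univ.image fun a : Fin (b j) => e ⟨j, a⟩ := by
      ext k
      simp only [hQ, Finset.mem_filter, Finset.mem_univ, true_and, Finset.mem_image]
      constructor
      · rintro rfl
        exact ⟨(e.symm k).2, by simp⟩
      · rintro ⟨a, rfl⟩
        simp
    rw [h1, Finset.card_image_of_injective]
    · simp
    · intro a a' h
      simpa using h
  set ℓ : Fin p → MvPolynomial (Fin n) ℝ := fun j => C ((b j : ℝ)⁻¹) * ∑ k ∈ Q j, X k with hℓ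
  set f : MvPolynomial (Fin n) ℝ := aeval (fun i => ℓ (J i)) g with hf
  have hℓd : ∀ j, (ℓ j).IsHomogeneous 1 := fun j =>
    (IsHomogeneous.sum _ _ _ fun k _ => isHomogeneous_X ℝ k).C_mul _
  have hfd : f.IsHomogeneous n := by
    have := hgd.aeval (fun i => ℓ (J i)) fun i => hℓd _
    rwa [one_mul] at this
  have hfeval : ∀ w : Fin n → ℝ,
      eval w f = eval (fun i => (b (J i) : ℝ)⁻¹ * ∑ k ∈ Q (J i), w k) g := by
    intro w
    have := comp_aeval_apply (R := ℝ) (f := fun i => ℓ (J i)) (aeval w) g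
    have hae : ∀ {k : ℕ} (x : Fin k → ℝ) (q : MvPolynomial (Fin k) ℝ), aeval x q = eval x q :=
      fun _ _ => rfl
    rw [hae, hae] at this
    rw [hf, this]
    simp [hℓ]
  have hfaeval : ∀ w : Fin n → ℂ,
      aeval w f = aeval (fun i => ((b (J i) : ℝ)⁻¹ : ℂ) * ∑ k ∈ Q (J i), w k) g := by
    intro w
    have := comp_aeval_apply (R := ℝ) (f := fun i => ℓ (J i)) (aeval w) g
    rw [hf, this]
    simp [hℓ]
  have hfge : ∀ w : Fin n → ℝ, (∀ k, 0 < w k) → a * ∏ k, w k ≤ eval w f := by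
    intro w hw
    rw [hfeval]
    set y : Fin p → ℝ := fun j => (b j : ℝ)⁻¹ * ∑ k ∈ Q j, w k with hy
    have hypos : ∀ j, b j ≠ 0 → 0 < y j := fun j hj => by
      have : 0 < ∑ k ∈ Q j, w k := Finset.sum_pos (fun k _ => hw k)
        (Finset.card_pos.1 (by rw [hQcard]; omega))
      positivity
    have hθz : ∀ i, b (J i) = 0 → θ i = 0 := fun i hi => by
      have := hθs (J i)
      rw [hi, Nat.cast_zero, Finset.sum_eq_zero_iff_of_nonneg fun i _ => hθ0 i] at this
      exact this i (hJ i)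
    -- In a block with `b j = 0` the average is 0, a boundary point not covered by `hge`. There `θ`
    -- vanishes, so the monomial is unaffected by replacing 0 with `ε`, and one lets `ε → 0`.
    have hlim : a * ∏ i, y (J i) ^ θ i ≤ eval (fun i => y (J i)) g := by
      have hcont : Continuous fun ε : ℝ =>
          eval (fun i => y (J i) + if b (J i) = 0 then ε else 0) g :=
        (MvPolynomial.continuous_eval g).comp (continuous_pi fun i => by split_ifs <;> fun_prop)
      have ht := hcont.tendsto 0
      simp only [ite_self, add_zero] at ht
      refine ge_of_tendsto
        (ht.mono_left (nhdsWithin_le_nhds : nhdsWithin (0 : ℝ) (Set.Ioi 0) ≤ _)) ?_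
      filter_upwards [self_mem_nhdsWithin] with ε hε
      have hε' : (0 : ℝ) < ε := hε
      have h1 := hge (fun i => y (J i) + if b (J i) = 0 then ε else 0) (fun i => by
        split_ifs with h
        · simpa [hy, h] using hε'
        · simpa using hypos _ h)
      refine le_of_eq_of_le ?_ h1
      congr 1
      refine Finset.prod_congr rfl fun i _ => ?_
      split_ifs with h
      · rw [hθz i h, Real.rpow_zero, Real.rpow_zero]
      · rw [add_zero]
    refine le_trans (mul_le_mul_of_nonneg_left ?_ ha.le) hlim
    rw [prod_univ_eq_prod_blocks hQdisj hQcov, prod_univ_eq_prod_blocks hM.disjoint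
      (fun x => ⟨J x, hJ x⟩)]
    refine Finset.prod_le_prod (fun j _ => Finset.prod_nonneg fun k _ => (hw k).le) fun j _ => ?_
    have h1 : ∏ i ∈ P j, y (J i) ^ θ i = y j ^ b j := by
      rw [Finset.prod_congr rfl fun i hi => by rw [(hPJ j i).1 hi]]
      by_cases hbj : b j = 0
      · rw [hbj, pow_zero]
        refine Finset.prod_eq_one fun i hi => ?_
        rw [hθz i (by rw [(hPJ j i).1 hi, hbj]), Real.rpow_zero]
      · rw [← Real.rpow_sum_of_pos (hypos j hbj), hθs j, Real.rpow_natCast]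
    rw [h1]
    have h2 := pow_mul_prod_rpow_le (Q j) (η := fun _ => 1) (z := w) (c := b j)
      (fun _ _ => zero_le_one) (fun _ _ => le_rfl) (by simp [hQcard]) (fun k _ => hw k)
    simp only [Real.rpow_one] at h2
    by_cases hbj : b j = 0
    · simpa [hbj] using h2
    · have hb0 : (0 : ℝ) < b j := by exact_mod_cast Nat.pos_of_ne_zero hbj
      rw [hy]
      simp only
      rw [mul_pow, inv_pow, ← div_eq_inv_mul, le_div_iff₀ (by positivity), mul_comm]
      exact h2
  -- The substituted values may vanish identically on blocks with `b j = 0`, so stability of `g`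
  -- alone is not enough; comparison with real parts on the closed half-plane and the positive lower
  -- bound `hfge` are used.
  have hfs : HurwitzStable f := by
    intro w hw h0
    rw [hfaeval] at h0
    have hre : ∀ i, (((b (J i) : ℝ)⁻¹ : ℂ) * ∑ k ∈ Q (J i), w k).re =
        (b (J i) : ℝ)⁻¹ * ∑ k ∈ Q (J i), (w k).re := fun i => by
      rw [← Complex.ofReal_inv, Complex.re_ofReal_mul, Complex.re_sum]
    have h1 := (hgs.hurwitzStable hgd).norm_eval_re_le hgd
      (fun i => ((b (J i) : ℝ)⁻¹ : ℂ) * ∑ k ∈ Q (J i), w k) (fun i => by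
        rw [hre]
        exact mul_nonneg (by positivity) (Finset.sum_nonneg fun k _ => (hw k).le))
    rw [h0, norm_zero] at h1
    simp_rw [hre] at h1
    have h2 := hfge (fun k => (w k).re) hw
    rw [hfeval, abs_nonpos_iff.1 h1] at h2
    have : 0 < a * ∏ k, (w k).re := mul_pos ha (Finset.prod_pos fun k _ => hw k)
    linarith
  -- Since `g` is multiaffine, only its `z^S` occur, and `z^S` becomes a product of powers of block
  -- sums with exponents `|S ∩ P j|`. The full square-free monomial appears only if these equal `|Q
  -- j| = b j`, which characterizes bases.
  have hcoeff : coeff (sqfreeExp Finset.univ) f =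
      (∏ j, (((b j).factorial : ℝ) / (b j : ℝ) ^ (b j))) * famCoeff (bases M) g := by
    have hterm : ∀ S : Finset (Fin m), ∏ i ∈ S, ℓ (J i) =
        C (∏ j, ((b j : ℝ)⁻¹) ^ (S ∩ P j).card) * blockPoly Q (fun j => (S ∩ P j).card) := by
      intro S
      have hfil : ∀ j, S.filter (fun i => J i = j) = S ∩ P j := fun j => by
        ext i
        simp [hPJ]
      rw [← Finset.prod_fiberwise' S J ℓ, map_prod, blockPoly, ← Finset.prod_mul_distrib]
      refine Finset.prod_congr rfl fun j _ => ?_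
      rw [Finset.prod_const, hfil, hℓ]
      simp only
      rw [mul_pow, map_pow]
    have hexp : f = ∑ S : Finset (Fin m), C (coeff (sqfreeExp S) g) * ∏ i ∈ S, ℓ (J i) := by
      rw [hf]
      conv_lhs => rw [hma.eq_genPoly]
      unfold genPoly
      rw [map_sum]
      refine Finset.sum_congr rfl fun S _ => ?_
      rw [aeval_monomial, Finsupp.prod_fintype _ _ (by simp), prod_pow_sqfreeExp]
      rfl
    rw [hexp, coeff_sum, famCoeff, Finset.mul_sum,
      ← Finset.sum_subset (Finset.subset_univ (bases M))]
    · refine Finset.sum_congr rfl fun S hS => ?_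
      have hSb := (hM.isBase_iff S).1 (mem_bases.1 hS)
      rw [hterm, coeff_C_mul, coeff_C_mul, coeff_sqfreeExp_blockPoly hQdisj hQcov,
        if_pos (fun j => by rw [Finset.univ_inter, hQcard, hSb])]
      simp_rw [hSb]
      rw [← Finset.prod_mul_distrib, mul_comm]
      congr 1
      refine Finset.prod_congr rfl fun j _ => ?_
      rw [inv_pow, div_eq_inv_mul]
    · intro S _ hS
      rw [hterm, coeff_C_mul, coeff_C_mul, coeff_sqfreeExp_blockPoly hQdisj hQcov, if_neg]
      · simp
      · intro h
        refine hS (mem_bases.2 ((hM.isBase_iff S).2 fun j => ?_))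
        rw [← h j, Finset.univ_inter, hQcard]
  have := hfs.factorial_le_coeff hfd ha hfge
  rw [hcoeff] at this
  rwa [mul_assoc]

/-! ### Numerical estimate for partition matroids. -/

/-- An upper Stirling bound. -/
lemma factorial_div_pow_le {c : ℕ} :
    (c.factorial : ℝ) / (c : ℝ) ^ c ≤ Real.exp (1 - c) * √(max c 1) := by
  rcases Nat.eq_zero_or_pos c with rfl | hc
  · simp
  · obtain ⟨k, rfl⟩ := Nat.exists_eq_succ_of_ne_zero hc.ne'
    -- The decreasing Stirling sequence is compared with its first value `e/√2`, which gives `c! ≤ e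
    -- √c (c/e)^c`. The maximum with 1 in the statement covers `c = 0`.
    have h := Stirling.stirlingSeq'_antitone (Nat.zero_le k)
    simp only [Function.comp_apply, Nat.succ_eq_add_one, zero_add, Stirling.stirlingSeq_one] at h
    unfold Stirling.stirlingSeq at h
    have hk : (0 : ℝ) < ((k + 1 : ℕ) : ℝ) := by positivity
    set x : ℝ := ((k + 1 : ℕ) : ℝ) with hx
    have hmax : max x 1 = x := max_eq_left (by rw [hx]; push_cast; linarith [k.cast_nonneg (α := ℝ)])
    rw [Nat.succ_eq_add_one, hmax]
    rw [div_le_iff₀ (by positivity), Real.sqrt_mul (by norm_num), div_pow] at h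
    rw [div_le_iff₀ (by positivity)]
    refine h.trans (le_of_eq ?_)
    have h2 : (0 : ℝ) < √2 := by positivity
    rw [Real.exp_sub, ← Real.exp_nat_mul, mul_one, ← hx]
    field_simp

/-- The numerical bound for partition matroids. -/
theorem IsPartitionMatroid.bound_le (hM : IsPartitionMatroid M P b)
    (hn : ∀ S ∈ bases M, S.card = n) :
    (m : ℝ) ^ m / (m.factorial : ℝ) *
        ∏ j, ((((P j).card - b j).factorial : ℝ) /
          (((P j).card - b j : ℕ) : ℝ) ^ ((P j).card - b j)) ≤
      Real.exp ((n : ℝ) + (p : ℝ)) * ((m : ℝ) / (p : ℝ)) ^ ((p : ℝ) / 2) := by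
  have h1 : (m : ℝ) ^ m / (m.factorial : ℝ) ≤ Real.exp m :=
    Real.pow_div_factorial_le_exp _ m.cast_nonneg m
  have hcard : ∀ j, (1 : ℝ) ≤ (P j).card := fun j => by
    exact_mod_cast Finset.card_pos.2 (hM.nonempty j)
  have hm : ∑ j, ((P j).card : ℝ) = m := by exact_mod_cast hM.sum_card
  have hbn : ∑ j, (b j : ℝ) = n := by exact_mod_cast hM.sum_eq hn
  have h2 : ∏ j, ((((P j).card - b j).factorial : ℝ) /
      (((P j).card - b j : ℕ) : ℝ) ^ ((P j).card - b j)) ≤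
      ∏ j, (Real.exp (1 - ((P j).card - b j)) * √((P j).card)) := by
    refine Finset.prod_le_prod (fun j _ => by positivity) fun j _ => ?_
    refine factorial_div_pow_le.trans ?_
    rw [Nat.cast_sub (hM.le_card j)]
    gcongr
    exact max_le (by linarith [(b j).cast_nonneg (α := ℝ)]) (hcard j)
  -- AM-GM for the block sizes, whose sum is `m`. For `p = 0` the right side is a power with
  -- exponent 0, hence 1.
  have h3 : ∏ j, √((P j).card : ℝ) ≤ ((m : ℝ) / p) ^ ((p : ℝ) / 2) := by
    rcases Nat.eq_zero_or_pos p with rfl | hp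
    · simp
    have hp0 : (0 : ℝ) < p := by exact_mod_cast hp
    have h := Real.geom_mean_le_arith_mean_weighted Finset.univ (fun _ : Fin p => (1 : ℝ) / p)
      (fun j => ((P j).card : ℝ)) (fun _ _ => by positivity)
      (by simp [hp0.ne']) (fun j _ => by positivity)
    rw [← Finset.mul_sum, hm] at h
    calc ∏ j, √((P j).card : ℝ)
        = (∏ j, ((P j).card : ℝ) ^ ((1 : ℝ) / p)) ^ ((p : ℝ) / 2) := by
          rw [← Real.finsetProd_rpow _ _ fun j _ => by positivity]
          refine Finset.prod_congr rfl fun j _ => ?_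
          rw [← Real.rpow_mul (by positivity), Real.sqrt_eq_rpow]
          congr 1
          field_simp
      _ ≤ (1 / p * (m : ℝ)) ^ ((p : ℝ) / 2) :=
          Real.rpow_le_rpow (Finset.prod_nonneg fun j _ => by positivity) h (by positivity)
      _ = _ := by rw [one_div_mul_eq_div]
  -- Together with `m^m/m! ≤ e^m` the exponent becomes `n + p`.
  have h4 : ∑ j, (1 - (((P j).card : ℝ) - b j)) = p - m + n := by
    rw [Finset.sum_sub_distrib, Finset.sum_sub_distrib, hm, hbn]
    simp
    ring
  calc _ ≤ Real.exp m * ∏ j, (Real.exp (1 - ((P j).card - b j)) * √((P j).card)) := by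
        gcongr
    _ = Real.exp (n + p) * ∏ j, √((P j).card : ℝ) := by
        rw [Finset.prod_mul_distrib, ← Real.exp_sum, h4, ← mul_assoc, ← Real.exp_add]
        congr 2
        ring
    _ ≤ _ := by gcongr

end Partition

end BCapacity

end

/-! ### Assembly of the three bounds. -/

theorem theorem2 {m n : ℕ} (M : Matroid (Fin m)) (hE : M.E = Set.univ)
    (hn : ∀ S ∈ BCapacity.bases M, S.card = n) :
    -- strongly Rayleigh distributions on the bases of the dual matroid
    (∀ (μ : Finset (Fin m) → ℝ) (P : ℝ),
      BCapacity.IsStronglyRayleighOn (BCapacity.bases M.dual) μ →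
      IsGreatest {r : ℝ | ∃ S ∈ BCapacity.bases M.dual, ∃ T ∈ BCapacity.bases M.dual,
        r = μ S / μ T} P →
      BCapacity.approxRatio n (BCapacity.bases M) ≤
          ((P * ((m : ℝ) ^ m / (m.factorial : ℝ)) : ℝ) : EReal) ∧
        BCapacity.approxRatioLin n (BCapacity.bases M) ≤ ((P * (2 : ℝ) ^ m : ℝ) : EReal)) ∧
    -- linear matroids
    (BCapacity.IsRealLinear M →
      BCapacity.approxRatio n (BCapacity.bases M) ≤
          ((BCapacity.unbalance M.dual * ((m : ℝ) ^ m / (m.factorial : ℝ)) : ℝ) : EReal) ∧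
        BCapacity.approxRatioLin n (BCapacity.bases M) ≤
          ((BCapacity.unbalance M.dual * (2 : ℝ) ^ m : ℝ) : EReal)) ∧
    -- partition matroids
    (∀ (p : ℕ) (P : Fin p → Finset (Fin m)) (b : Fin p → ℕ),
      BCapacity.IsPartitionMatroid M P b →
      BCapacity.approxRatio n (BCapacity.bases M) ≤
          (((m : ℝ) ^ m / (m.factorial : ℝ) *
            ∏ j, ((((P j).card - b j).factorial : ℝ) /
              (((P j).card - b j : ℕ) : ℝ) ^ ((P j).card - b j)) : ℝ) : EReal) ∧
        (m : ℝ) ^ m / (m.factorial : ℝ) *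
            ∏ j, ((((P j).card - b j).factorial : ℝ) /
              (((P j).card - b j : ℕ) : ℝ) ^ ((P j).card - b j)) ≤
          Real.exp ((n : ℝ) + (p : ℝ)) * ((m : ℝ) / (p : ℝ)) ^ ((p : ℝ) / 2) ∧
        BCapacity.approxRatioLin n (BCapacity.bases M) ≤
          (((n : ℝ) ^ n / (n.factorial : ℝ) *
            ∏ j, (((b j).factorial : ℝ) / (b j : ℝ) ^ (b j)) : ℝ) : EReal)) := by
  refine ⟨fun μ P hμ hP => ?_, fun hM => ?_, fun p P b hM => ⟨?_, hM.bound_le hn, ?_⟩⟩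
  · have hcard : ∀ S, μ S ≠ 0 → S.card = m - n := fun S hS => by
      by_contra hne
      refine hS (hμ.zero S fun hmem => hne ?_)
      have h1 := hn _ ((BCapacity.mem_bases_dual hE).1 hmem)
      have h2 := Finset.card_compl S
      have h3 := Finset.card_le_univ S
      rw [Fintype.card_fin] at h2 h3
      omega
    have hs := hμ.stable.hurwitzStable (BCapacity.isHomogeneous_genPoly hcard)
    have hr : ∀ S ∈ BCapacity.bases M.dual, ∀ T ∈ BCapacity.bases M.dual, μ S / μ T ≤ P :=
      fun S hS T hT => hP.2 ⟨S, hS, T, hT, rfl⟩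
    exact ⟨BCapacity.approxRatio_le fun g hg hgs hgd hgB =>
        (BCapacity.capacity_div_le_of_weight hE hn hμ.pos hμ.zero hs hr hg hgs hgd hgB).1,
      BCapacity.approxRatioLin_le fun g hg hma hgs hgd hgB =>
        (BCapacity.capacity_div_le_of_weight hE hn hμ.pos hμ.zero hs hr hg hgs hgd hgB).2 hma⟩
  · exact ⟨BCapacity.approxRatio_le fun g hg hgs hgd hgB =>
        (BCapacity.capacity_div_le_of_isRealLinear hE hn hM hg hgs hgd hgB).1,
      BCapacity.approxRatioLin_le fun g hg hma hgs hgd hgB =>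
        (BCapacity.capacity_div_le_of_isRealLinear hE hn hM hg hgs hgd hgB).2 hma⟩
  · exact BCapacity.approxRatio_le fun g hg hgs hgd hgB => hM.capacity_div_le hn hg hgs hgd hgB
  · exact BCapacity.approxRatioLin_le fun g hg hma hgs hgd hgB =>
      hM.capacity_div_le_of_multiaffine hn hg hma hgs hgd hgB
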